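/- Let $Q$ be a finite quiver without loops and without oriented 2-cycles, with vertex set $V$. Let $\mathcal A_Q\subset\mathbb Q(x_v : v\in V)$ be its cluster algebra, i.e. the $\mathbb Z$-algebra generated by all cluster variables obtained from the initial seed $(Q,(x_v)_{v\in V})$ by finite sequences of mutations. Here mutation of a seed at a vertex $j$ mutates the quiver at $j$ (reverse all arrows at $j$, complete each path of length two with middle vertex $j$ to an oriented triangle, remove a maximal collection of oriented 2-cycles) and replaces $x_j$ by $x_j'=\bigl(\prod_{i\to j}x_i+\prod_{j\to i}x_i\bigr)/x_j$, where the products are over the arrows of the quiver before mutation and the $x_i$ denote the cluster variables of the seed being mutated. Let $\sigma$ be a partial labelling of the vertices of $Q$ by elements of $\{1,-1\}$ (possibly no vertex or every vertex is labelled), and let $F\subseteq V$ be the set of unlabelled vertices. Then $\mathcal A_Q\subseteq\mathbb Z[x_v^{\pm1} : v\in V]$ (the Laurent phenomenon), so that the specialised cluster algebra $\mathcal A_Q|_\sigma\subseteq\mathbb Z[x_v^{\pm1} : v\in F]$ is well defined as the image of $\mathcal A_Q$ under the ring homomorphism that sends $x_v$ to its label if $v$ is labelled and to $x_v$ if $v\in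 F$. Moreover, for every vertex $j$ the following are equivalent: 1. $j$ is polyamorous, that is, $j$ is not labelled and every element of $\mathcal A_Q|_\sigma$ is polynomial in $x_j$ (no negative power of $x_j$ occurs in it); 2. the neighbourhood of $j$ is a polycule, that is, $j$ is not labelled, every neighbour of $j$ is labelled, and the number of arrows (in either direction) connecting $j$ with vertices labelled $-1$ is odd. -/

import Mathlib

noncomputable section

namespace ClusterAlg

universe u w

/-! ### Seeds and mutation -/

/-- The field `ℚ(x_v : v ∈ V)` of rational functions, as the fraction field of `ℤ[x_v : v ∈ V]`. -/
abbrev RatFunField (V : Type u) : Type u := FractionRing (MvPolynomial V ℤ)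

/-- The initial cluster variable `x_v`. -/
def initialVar (V : Type u) (v : V) : RatFunField V :=
  algebraMap (MvPolynomial V ℤ) (RatFunField V) (MvPolynomial.X v)

/-- A seed: a quiver on the vertex set `V`, given up to isomorphism fixing the vertices by the
number `arrows a b` of arrows `a → b`, together with a cluster indexed by the vertices. -/
structure Seed (V : Type u) where
  arrows : V → V → ℕ
  cluster : V → RatFunField V

/-- Mutation at `j` of a quiver given by its numbers of arrows: the arrows incident to `j` are
reversed, every path `a → j → b` of the original quiver creates a new arrow `a → b` (closing the
reversed path `b → j → a` to an oriented triangle), and a maximal collection of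
oriented 2-cycles is removed, which is what the truncated subtraction does. -/
def mutateArrows {V : Type u} [DecidableEq V] (q : V → V → ℕ) (j : V) : V → V → ℕ :=
  fun a b =>
    if a = j ∨ b = j then q b a
    else (q a b + q a j * q j b) - (q b a + q b j * q j a)

/-- Seed mutation at `j`; `x_j` becomes `(∏_{i → j} x_i + ∏_{j → i} x_i) / x_j`, where the products
are over arrows. -/
def Seed.mutate {V : Type u} [Fintype V] [DecidableEq V] (s : Seed V) (j : V) : Seed V where
  arrows := mutateArrows s.arrows j
  cluster := Function.update s.cluster j
    ((∏ i, s.cluster i ^ s.arrows i j + ∏ i, s.cluster i ^ s.arrows j i) / s.cluster j)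

/-- The initial seed of a finite quiver. -/
def initialSeed (V : Type u) [Quiver.{w} V] : Seed V where
  arrows a b := Nat.card (a ⟶ b)
  cluster := initialVar V

/-- All elements of all clusters of the seeds obtained from the initial one by finite sequences
of mutations. -/
def clusterVariables (V : Type u) [Fintype V] [DecidableEq V] [Quiver.{w} V] :
    Set (RatFunField V) :=
  {y | ∃ (ks : List V) (v : V), y = (ks.foldl Seed.mutate (initialSeed V)).cluster v}

/-- The cluster algebra of the quiver `V`: the `ℤ`-algebra (that is, the subring)
generated by all cluster variables. -/
def clusterAlgebra (V : Type u) [Fintype V] [DecidableEq V] [Quiver.{w} V] :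
    Subring (RatFunField V) :=
  Subring.closure (clusterVariables V)

/-! ### Laurent polynomials and specialisation -/

/-- Laurent polynomials with integer coefficients in the variables `x_v`, `v ∈ V` (for finite `V`);
`AddMonoidAlgebra.single e c` is the term `c ∏_v x_v ^ e v`. -/
abbrev Laurent (V : Type u) : Type u := AddMonoidAlgebra ℤ (V → ℤ)

/-- Evaluation of Laurent polynomials at invertible elements `t v`: it sends `∏_v x_v ^ e v`
to `∏_v t v ^ e v`. -/
def Laurent.eval {V : Type u} [Fintype V] {R : Type*} [CommRing R] (t : V → Rˣ) :
    Laurent V →+* R :=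
  (AddMonoidAlgebra.lift ℤ R (V → ℤ)
    { toFun := fun e => ((∏ v, t v ^ (Multiplicative.toAdd e v) : Rˣ) : R)
      map_one' := by simp
      map_mul' := fun a b => by simp [zpow_add, Finset.prod_mul_distrib] }).toRingHom

/-- The variable `x_v`, as an invertible Laurent polynomial. -/
def Laurent.var {V : Type u} [DecidableEq V] (v : V) : (Laurent V)ˣ where
  val := AddMonoidAlgebra.single (Pi.single v 1) 1
  inv := AddMonoidAlgebra.single (-Pi.single v 1) 1
  val_inv := by simp [AddMonoidAlgebra.single_mul_single, AddMonoidAlgebra.one_def]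
  inv_val := by simp [AddMonoidAlgebra.single_mul_single, AddMonoidAlgebra.one_def]

theorem initialVar_ne_zero {V : Type u} (v : V) : initialVar V v ≠ 0 := by
  unfold initialVar
  rw [Ne, FaithfulSMul.algebraMap_eq_zero_iff]
  exact MvPolynomial.X_ne_zero v

/-- The inclusion of `ℤ[x_v, x_v⁻¹ : v ∈ V]` into the field of rational functions. -/
def Laurent.toField (V : Type u) [Fintype V] : Laurent V →+* RatFunField V :=
  Laurent.eval fun v => Units.mk0 (initialVar V v) (initialVar_ne_zero v)

/-- A partial labelling of the vertices by `1` and `-1`; `none` means that the vertex is not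
labelled. -/
abbrev Labelling (V : Type u) : Type u := V → Option ℤˣ

/-- The unlabelled vertices. -/
abbrev Labelling.Free {V : Type u} (σ : Labelling V) : Type u := {v : V // σ v = none}

/-- The invertible element which the specialisation `σ` substitutes for `x_v`: the label of `v`
if there is one, and `x_v` itself otherwise. -/
def Labelling.value {V : Type u} [DecidableEq V] (σ : Labelling V) (v : V) :
    (Laurent σ.Free)ˣ :=
  match h : σ v with
  | none => Laurent.var ⟨v, h⟩
  | some a => Units.map (algebraMap ℤ (Laurent σ.Free) : ℤ →* Laurent σ.Free) a

/-- The specialisation of Laurent polynomials by `σ`, with values in the Laurent polynomials in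
the remaining variables. -/
def specialise {V : Type u} [Fintype V] [DecidableEq V] (σ : Labelling V) :
    Laurent V →+* Laurent σ.Free :=
  Laurent.eval σ.value

/-- The specialised cluster algebra: the image under the specialisation of the cluster algebra,
viewed inside the ring of Laurent polynomials in the initial cluster variables (where it lies by
the Laurent phenomenon). -/
def specialisedClusterAlgebra {V : Type u} [Fintype V] [DecidableEq V] [Quiver.{w} V]
    (σ : Labelling V) : Subring (Laurent σ.Free) :=
  ((clusterAlgebra V).comap (Laurent.toField V)).map (specialise σ)

/-- A Laurent polynomial is polynomial in `x_j` if `x_j` has no negative exponent in it. -/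
def Laurent.IsPolynomialIn {V : Type u} (f : Laurent V) (j : V) : Prop :=
  ∀ e : V → ℤ, f.coeff e ≠ 0 → 0 ≤ e j

/-- The vertex `j` is polyamorous: it is not labelled, and all elements of the specialised cluster
algebra are polynomial in `x_j`. -/
def IsPolyamorous {V : Type u} [Fintype V] [DecidableEq V] [Quiver.{w} V]
    (σ : Labelling V) (j : V) : Prop :=
  ∃ h : σ j = none, ∀ f ∈ specialisedClusterAlgebra σ, f.IsPolynomialIn ⟨j, h⟩

/-- The neighbourhood of `j` is a polycule: `j` is not labelled, all its neighbours are, and the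
number of arrows connecting `j` with vertices labelled `-1` is odd. -/
def IsPolycule {V : Type u} [Fintype V] [Quiver.{w} V]
    (σ : Labelling V) (j : V) : Prop :=
  σ j = none ∧
  (∀ i : V, Nonempty (i ⟶ j) ∨ Nonempty (j ⟶ i) → σ i ≠ none) ∧
  Odd (∑ i : V with σ i = some (-1), (Nat.card (i ⟶ j) + Nat.card (j ⟶ i)))

end ClusterAlg

end

/-! Write P_j for the exchange polynomial at j, so that mutating the initial seed at j produces P_j
/ x_j. Without loops, P_j does not involve x_j, and σ sends it to a sum of two signed monomials.
This sum vanishes exactly when the monomials agree and the signs are opposite, which in the absence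
of 2-cycles is the polycule condition (`isPolycule_iff`). If it does not vanish, P_j / x_j itself
specialises to an element with a negative power of x_j (`specialise_quiverExchange_eq_zero`).

For the converse, let an element be a Laurent polynomial both in the initial cluster and in its
mutation at j. Then its part of degree -n in x_j is divisible by P_j^n
(`Laurent.pow_dvd_component_of_evalAt_eq`), so all parts of negative degree die once P_j specialises
to 0. That cluster variables have both expansions is shown by the method of upper bounds: the
elements that are Laurent in a cluster and in all its neighbours at mutable vertices for a mutated
seed remain so for the original seed (`IsAdmissible.mem_upperBound_of_mutate`).

That method needs exchange polynomials to be coprime in a suitable sense, which may fail for Q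
itself. Hence the argument runs with principal coefficients, where the mutable columns of the
exchange matrix are independent. Setting the coefficients to 1 recovers the seeds of Q
(`IsLift.foldl`) and preserves divisibility by powers of P_j. -/

noncomputable section

namespace ClusterAlg

open AddMonoidAlgebra

universe u w

/-! ### Graded components of Laurent polynomials -/

namespace Laurent

variable {W : Type u}

/-- The component of degree `n` for the grading defined by an additive map on the exponents. -/
def component (φ : (W → ℤ) →+ ℤ) (n : ℤ) : Laurent W →+ Laurent W where
  toFun f := ofCoeff (f.coeff.filter fun e => φ e = n)
  map_zero' := by ext; simp [Finsupp.filter_apply]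
  map_add' f g := by simp [Finsupp.filter_add]

theorem coeff_component (φ : (W → ℤ) →+ ℤ) (n : ℤ) (f : Laurent W) (e : W → ℤ) :
    (component φ n f).coeff e = if φ e = n then f.coeff e else 0 := by
  simp [component, Finsupp.filter_apply]

theorem component_single (φ : (W → ℤ) →+ ℤ) (n : ℤ) (e : W → ℤ) (c : ℤ) :
    component φ n (single e c) = if φ e = n then single e c else 0 := by
  split_ifs with h
  · exact congrArg ofCoeff (Finsupp.filter_single_of_pos _ h)
  · exact congrArg ofCoeff (Finsupp.filter_single_of_neg _ h)

theorem component_single_mul (φ : (W → ℤ) →+ ℤ) (n : ℤ) (e : W → ℤ) (c : ℤ) (f : Laurent W) :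
    component φ n (single e c * f) = single e c * component φ (n - φ e) f := by
  induction f using AddMonoidAlgebra.induction_linear with
  | zero => simp
  | add f g hf hg => simp only [mul_add, map_add, hf, hg]
  | single a d =>
    rw [single_mul_single, component_single, component_single, map_add]
    by_cases h : φ a = n - φ e
    · rw [if_pos h, if_pos (by omega), single_mul_single]
    · rw [if_neg h, if_neg (by omega), mul_zero]

/-- Equal degrees make the binomial homogeneous, so multiplication by it only shifts the grading. -/
theorem component_binomial_mul (φ : (W → ℤ) →+ ℤ) {a b : W → ℤ} (h : φ a = φ b) (n : ℤ)
    (c d : ℤ) (f : Laurent W) :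
    component φ n ((single a c + single b d) * f) =
      (single a c + single b d) * component φ (n - φ a) f := by
  rw [add_mul, map_add, component_single_mul, component_single_mul, ← h, add_mul]

theorem component_pow_mul {φ : (W → ℤ) →+ ℤ} {p : Laurent W}
    (hp : ∀ n f, component φ n (p * f) = p * component φ n f) (m : ℕ) (n : ℤ) (f : Laurent W) :
    component φ n (p ^ m * f) = p ^ m * component φ n f := by
  induction m generalizing f with
  | zero => simp
  | succ m ih => rw [pow_succ, mul_assoc, ih, hp, ← mul_assoc]

theorem eq_sum_component (φ : (W → ℤ) →+ ℤ) (f : Laurent W) :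
    f = ∑ n ∈ f.coeff.support.image φ, component φ n f := by
  classical
  ext e
  simp only [coeff_sum, Finsupp.finsetSum_apply, coeff_component, Finset.sum_ite_eq]
  split_ifs with h
  · rfl
  · by_contra h0
    exact h (Finset.mem_image_of_mem _ (Finsupp.mem_support_iff.2 h0))

theorem eq_zero_of_component (φ : (W → ℤ) →+ ℤ) {f : Laurent W}
    (h : ∀ n, component φ n f = 0) : f = 0 := by
  rw [eq_sum_component φ f]
  exact Finset.sum_eq_zero fun n _ => h n

theorem dvd_of_component (φ : (W → ℤ) →+ ℤ) {d f : Laurent W}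
    (h : ∀ n, d ∣ component φ n f) : d ∣ f := by
  rw [eq_sum_component φ f]
  exact Finset.dvd_sum fun n _ => h n

theorem exists_forall_component_eq_zero (φ : (W → ℤ) →+ ℤ) (f : Laurent W) :
    ∃ N : ℤ, ∀ n, N < n → component φ n f = 0 := by
  obtain ⟨N, hN⟩ := (f.coeff.support.image φ).bddAbove
  refine ⟨N, fun n hn => ?_⟩
  ext e
  rw [coeff_component]
  split_ifs with h
  · by_contra h0
    have := hN (Finset.mem_coe.2 (Finset.mem_image_of_mem φ (Finsupp.mem_support_iff.2 h0)))
    omega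
  · rfl

theorem single_mul_single_neg (e : W → ℤ) :
    (single (-e) 1 * single e 1 : Laurent W) = 1 := by
  simp [single_mul_single, AddMonoidAlgebra.one_def]

/-- A binomial with terms of different degrees is regular modulo a homogeneous binomial. -/
theorem dvd_of_dvd_binomial_mul (φ : (W → ℤ) →+ ℤ) {a b c d : W → ℤ} (hab : φ a = φ b)
    (hcd : φ c ≠ φ d) {g : Laurent W}
    (h : (single a 1 + single b 1 : Laurent W) ∣ (single c 1 + single d 1) * g) :
    (single a 1 + single b 1 : Laurent W) ∣ g := by
  wlog hlt : φ d < φ c generalizing c d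
  · exact this hcd.symm (by rwa [add_comm (single d 1)]) (lt_of_le_of_ne (not_lt.1 hlt) hcd)
  obtain ⟨h, hh⟩ := h
  obtain ⟨N, hN⟩ := exists_forall_component_eq_zero φ g
  refine dvd_of_component φ fun n => ?_
  -- Descending induction on the degree: the components of `g` above `N` vanish, and degree `n + φ
  -- c` of the product involves `g` only in degree `n` and in the higher degree `n + φ c - φ d`.
  have key : ∀ (m : ℕ) (n : ℤ), N - n < m → (single a 1 + single b 1 : Laurent W) ∣
      component φ n g := by
    intro m
    induction m with
    | zero =>
      intro n hn
      rw [hN n (by push_cast at hn; omega)]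
      exact dvd_zero _
    | succ m ih =>
      intro n hn
      have h1 := congrArg (component φ (n + φ c)) hh
      rw [component_binomial_mul φ hab, add_mul, map_add, component_single_mul,
        component_single_mul, add_sub_cancel_right] at h1
      have h2 := ih (n + φ c - φ d) (by push_cast at hn; omega)
      have h3 : (single a 1 + single b 1 : Laurent W) ∣ single c 1 * component φ n g := by
        rw [← dvd_add_left (h2.mul_left (single d 1)), h1]
        exact dvd_mul_right _ _
      have h4 := h3.mul_left (single (-c) 1)
      rwa [← mul_assoc, single_mul_single_neg, one_mul] at h4
  exact key (N - n + 1).toNat n (by omega)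

/-! ### Evaluation in a field -/

/-- Evaluation of Laurent polynomials at nonzero elements of a field. -/
def evalAt [Fintype W] {K : Type*} [Field K] (x : W → K) (hx : ∀ i, x i ≠ 0) : Laurent W →+* K :=
  eval fun i => Units.mk0 (x i) (hx i)

theorem eval_single [Fintype W] {R : Type*} [CommRing R] (t : W → Rˣ) (e : W → ℤ) (c : ℤ) :
    eval t (single e c) = c * ((∏ v, t v ^ e v : Rˣ) : R) := by
  simp [eval, AddMonoidAlgebra.lift_single]

theorem evalAt_single [Fintype W] {K : Type*} [Field K] (x : W → K) (hx : ∀ i, x i ≠ 0)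
    (e : W → ℤ) (c : ℤ) : evalAt x hx (single e c) = c * ∏ i, x i ^ e i := by
  simp [evalAt, eval_single, Units.coe_prod]

end Laurent

/-- The exponent vector with the sign of the entry at `k` changed. -/
def negAt {W : Type u} [DecidableEq W] (k : W) (e : W → ℤ) : W → ℤ := Function.update e k (-e k)

theorem negAt_injective {W : Type u} [DecidableEq W] (k : W) :
    Function.Injective (negAt k) := by
  refine Function.LeftInverse.injective (g := negAt k) fun e => ?_
  simp [negAt]

/-! ### Substitution of p / x_k for x_k -/

namespace Laurent

variable {W : Type u} [Fintype W] [DecidableEq W] {K : Type*} [Field K]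

theorem prod_update_zpow (x : W → K) (k : W) (y : K) (e : W → ℤ) :
    ∏ i, Function.update x k y i ^ e i = y ^ e k * ∏ i, x i ^ Function.update e k 0 i := by
  rw [← Finset.mul_prod_erase _ _ (Finset.mem_univ k),
    ← Finset.mul_prod_erase _ (fun i => x i ^ Function.update e k 0 i) (Finset.mem_univ k)]
  simp only [Function.update_self, zpow_zero, one_mul]
  congr 1
  refine Finset.prod_congr rfl fun i hi => ?_
  rw [Function.update_of_ne (Finset.ne_of_mem_erase hi),
    Function.update_of_ne (Finset.ne_of_mem_erase hi)]

theorem prod_zpow_negAt (x : W → K) (k : W) (e : W → ℤ) :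
    ∏ i, x i ^ negAt k e i = x k ^ (-e k) * ∏ i, x i ^ Function.update e k 0 i := by
  conv_lhs => rw [← Function.update_eq_self k x]
  rw [prod_update_zpow]
  simp [negAt]

/-- Clearing denominators in the substitution of `p / x_k` for `x_k`. -/
theorem exists_evalAt_eq_pow_mul (x : W → K) (hx : ∀ i, x i ≠ 0) (k : W) (p : Laurent W)
    (hp : ∀ n f, component (Pi.evalAddMonoidHom (fun _ => ℤ) k) n (p * f) =
      p * component (Pi.evalAddMonoidHom (fun _ => ℤ) k) n f)
    (hx' : ∀ i, Function.update x k (evalAt x hx p / x k) i ≠ 0) (g : Laurent W) :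
    ∃ N₀ : ℕ, ∀ N : ℕ, N₀ ≤ N → ∃ h : Laurent W,
      evalAt x hx h = evalAt x hx p ^ N * evalAt _ hx' g ∧
      ∀ n, component (Pi.evalAddMonoidHom (fun _ => ℤ) k) (-n) h =
        p ^ (N + n).toNat *
          mapDomain (negAt k) (component (Pi.evalAddMonoidHom (fun _ => ℤ) k) n g) := by
  have hp' := component_pow_mul hp
  have hp0 : evalAt x hx p ≠ 0 := by
    have := hx' k
    rw [Function.update_self] at this
    exact (div_ne_zero_iff.1 this).1
  induction g using AddMonoidAlgebra.induction_linear with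
  | zero => exact ⟨0, fun N _ => ⟨0, by simp, by simp⟩⟩
  | add f g hf hg =>
    obtain ⟨N₁, h₁⟩ := hf
    obtain ⟨N₂, h₂⟩ := hg
    refine ⟨max N₁ N₂, fun N hN => ?_⟩
    obtain ⟨a, ha, ha'⟩ := h₁ N (le_trans (le_max_left _ _) hN)
    obtain ⟨b, hb, hb'⟩ := h₂ N (le_trans (le_max_right _ _) hN)
    refine ⟨a + b, by rw [map_add, map_add, ha, hb, mul_add], fun n => ?_⟩
    rw [map_add, map_add, ha', hb', mapDomain_add, mul_add]
  | single e c =>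
    -- p^N (p / x_k)^(e k) = p^(N + e k) x_k^(-e k); the bound on `N` keeps `toNat` from truncating.
    refine ⟨(e k).natAbs, fun N hN => ⟨p ^ (N + e k).toNat * single (negAt k e) c, ?_, ?_⟩⟩
    · rw [map_mul, map_pow, evalAt_single, evalAt_single, prod_update_zpow, prod_zpow_negAt,
        div_zpow, ← zpow_natCast, ← zpow_natCast, Int.toNat_of_nonneg (by omega), zpow_add₀ hp0,
        zpow_neg]
      field_simp
    · intro n
      rw [hp', component_single, component_single]
      simp only [Pi.evalAddMonoidHom_apply]
      by_cases h : e k = n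
      · rw [if_pos h, if_pos (by simp [negAt, h]), mapDomain_single, h]
      · rw [if_neg h, if_neg (by simpa [negAt] using h), mapDomain_zero, mul_zero, mul_zero]

/-- A relation among the new variables becomes, after clearing denominators, a relation among the
old ones, whose components are those of `g` reflected and multiplied by powers of `p ≠ 0`. -/
theorem evalAt_update_injective (x : W → K) (hx : ∀ i, x i ≠ 0)
    (hinj : Function.Injective (evalAt x hx)) (k : W) (p : Laurent W)
    (hp : ∀ n f, component (Pi.evalAddMonoidHom (fun _ => ℤ) k) n (p * f) =
      p * component (Pi.evalAddMonoidHom (fun _ => ℤ) k) n f)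
    (hx' : ∀ i, Function.update x k (evalAt x hx p / x k) i ≠ 0) :
    Function.Injective (evalAt _ hx') := by
  have hp0 : p ≠ 0 := by
    rintro rfl
    simpa using hx' k
  rw [injective_iff_map_eq_zero]
  intro g hg
  obtain ⟨N, hN⟩ := exists_evalAt_eq_pow_mul x hx k p hp hx' g
  obtain ⟨h, h1, h2⟩ := hN N le_rfl
  rw [hg, mul_zero] at h1
  have h0 : h = 0 := (injective_iff_map_eq_zero _).1 hinj h h1
  refine eq_zero_of_component (Pi.evalAddMonoidHom (fun _ => ℤ) k) fun n => ?_
  have h3 := h2 n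
  rw [h0, map_zero] at h3
  have h4 := (mul_eq_zero.1 h3.symm).resolve_left (pow_ne_zero _ hp0)
  exact mapDomain_injective (negAt_injective k) (by rw [h4, mapDomain_zero])

/-- Substituting p / x_k turns the part of `g` of degree n into p^n times a part of degree -n; the
power p^N used to clear denominators cancels. -/
theorem pow_dvd_component_of_evalAt_eq (x : W → K) (hx : ∀ i, x i ≠ 0)
    (hinj : Function.Injective (evalAt x hx)) (k : W) (p : Laurent W)
    (hp : ∀ n f, component (Pi.evalAddMonoidHom (fun _ => ℤ) k) n (p * f) =
      p * component (Pi.evalAddMonoidHom (fun _ => ℤ) k) n f)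
    (hx' : ∀ i, Function.update x k (evalAt x hx p / x k) i ≠ 0) {f g : Laurent W}
    (hfg : evalAt x hx f = evalAt _ hx' g) (n : ℕ) :
    p ^ n ∣ component (Pi.evalAddMonoidHom (fun _ => ℤ) k) (-n) f := by
  have hp0 : p ≠ 0 := by
    rintro rfl
    simpa using hx' k
  have hp' := component_pow_mul hp
  obtain ⟨N, hN⟩ := exists_evalAt_eq_pow_mul x hx k p hp hx' g
  obtain ⟨h, h1, h2⟩ := hN N le_rfl
  have h0 : h = p ^ N * f := hinj (by rw [h1, map_mul, map_pow, hfg])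
  have h3 := h2 n
  rw [h0, hp', ← Nat.cast_add, Int.toNat_natCast, pow_add, mul_assoc] at h3
  exact ⟨_, mul_left_cancel₀ (pow_ne_zero N hp0) h3⟩

end Laurent

/-! ### Regular elements modulo an element of a subring of a field -/

section Regular

variable {K : Type*} [Field K]

/-- Multiplication by `r` is injective modulo `d` in the subring `S`. -/
def IsRegularMod (S : Subring K) (d r : K) : Prop :=
  ∀ g ∈ S, ∀ h ∈ S, r * g = d * h → ∃ h' ∈ S, g = d * h'

theorem IsRegularMod.mul {S : Subring K} {d r s : K} (hs : s ∈ S) (hr' : IsRegularMod S d r)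
    (hs' : IsRegularMod S d s) : IsRegularMod S d (r * s) := by
  intro g hg h hh e
  obtain ⟨h', hh', e'⟩ := hr' (s * g) (S.mul_mem hs hg) h hh (by rw [← mul_assoc, e])
  exact hs' g hg h' hh' e'

theorem IsRegularMod.pow {S : Subring K} {d r : K} (hr : r ∈ S) (hr' : IsRegularMod S d r)
    (n : ℕ) : IsRegularMod S d (r ^ n) := by
  induction n with
  | zero => exact fun g _ h hh e => ⟨h, hh, by simpa using e⟩
  | succ n ih => rw [pow_succ]; exact ih.mul hr hr'

/-- Modulo `d` the element `r` is the unit `u`. -/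
theorem isRegularMod_of_eq_unit_add {S : Subring K} {d r u s : K} (hu : u ≠ 0) (hu' : u⁻¹ ∈ S)
    (hs : s ∈ S) (h : r = u + d * s) : IsRegularMod S d r := by
  intro g hg h' hh' e
  refine ⟨u⁻¹ * (h' - s * g), S.mul_mem hu' (S.sub_mem hh' (S.mul_mem hs hg)), ?_⟩
  have : u * g = d * (h' - s * g) := by rw [mul_sub, ← e, h]; ring
  rw [mul_left_comm, ← this, inv_mul_cancel_left₀ hu]

/-- An element whose denominator can be taken to be a power of `d` or a power of `r` has none when
`r` is regular modulo `d`: the factors `d` are removed one at a time. -/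
theorem mem_of_isRegularMod {S : Subring K} {d r f : K} (hd : d ≠ 0) (hr : r ∈ S)
    (hreg : IsRegularMod S d r) {m n : ℕ} (hm : r ^ m * f ∈ S) (hn : d ^ n * f ∈ S)
    (hdS : d ∈ S) : f ∈ S := by
  induction n with
  | zero => simpa using hn
  | succ n ih =>
    refine ih ?_
    obtain ⟨h, hh, e⟩ := hreg.pow hr m _ hn (d ^ n * (r ^ m * f))
      (S.mul_mem (S.pow_mem hdS n) hm) (by ring)
    have : d ^ n * f = h := mul_left_cancel₀ hd (by rw [← e]; ring)
    rwa [this]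

end Regular

/-! ### Subrings of Laurent polynomials in the elements of a cluster -/

section LaurentRing

variable {W : Type u} {K : Type*} [Field K]

/-- The subring generated by the elements of a cluster and their inverses. -/
def laurentRing (x : W → K) : Subring K :=
  Subring.closure (Set.range x ∪ Set.range fun i => (x i)⁻¹)

theorem mem_laurentRing (x : W → K) (i : W) : x i ∈ laurentRing x :=
  Subring.subset_closure (Or.inl ⟨i, rfl⟩)

theorem inv_mem_laurentRing (x : W → K) (i : W) : (x i)⁻¹ ∈ laurentRing x :=
  Subring.subset_closure (Or.inr ⟨i, rfl⟩)

theorem zpow_mem_laurentRing (x : W → K) (i : W) (n : ℤ) : x i ^ n ∈ laurentRing x := by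
  cases n with
  | ofNat n => simpa using Subring.pow_mem _ (mem_laurentRing x i) n
  | negSucc n =>
    rw [zpow_negSucc, ← inv_pow]
    exact Subring.pow_mem _ (inv_mem_laurentRing x i) _

/-- Denominators need only be bounded on the generators, since they add up under sums and products.
-/
theorem exists_pow_mul_mem {S : Subring K} {r : K} (hr : r ∈ S) {x : W → K}
    (h : ∀ i, ∃ n : ℕ, r ^ n * x i ∈ S) (h' : ∀ i, ∃ n : ℕ, r ^ n * (x i)⁻¹ ∈ S) {f : K}
    (hf : f ∈ laurentRing x) : ∃ n : ℕ, r ^ n * f ∈ S := by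
  induction hf using Subring.closure_induction with
  | mem y hy =>
    rcases hy with ⟨i, rfl⟩ | ⟨i, rfl⟩
    exacts [h i, h' i]
  | zero => exact ⟨0, by simp⟩
  | one => exact ⟨0, by simp⟩
  | add a b _ _ ha hb =>
    obtain ⟨m, hm⟩ := ha
    obtain ⟨n, hn⟩ := hb
    refine ⟨m + n, ?_⟩
    have : r ^ (m + n) * (a + b) = r ^ n * (r ^ m * a) + r ^ m * (r ^ n * b) := by ring
    rw [this]
    exact S.add_mem (S.mul_mem (S.pow_mem hr _) hm) (S.mul_mem (S.pow_mem hr _) hn)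
  | neg a _ ha =>
    obtain ⟨m, hm⟩ := ha
    exact ⟨m, by rw [mul_neg]; exact S.neg_mem hm⟩
  | mul a b _ _ ha hb =>
    obtain ⟨m, hm⟩ := ha
    obtain ⟨n, hn⟩ := hb
    refine ⟨m + n, ?_⟩
    have : r ^ (m + n) * (a * b) = (r ^ m * a) * (r ^ n * b) := by ring
    rw [this]
    exact S.mul_mem hm hn

variable [Fintype W]

/-- A Laurent monomial in the elements of a cluster. -/
def monomialAt (x : W → K) (e : W → ℤ) : K := ∏ i, x i ^ e i

theorem monomialAt_mem (x : W → K) (e : W → ℤ) : monomialAt x e ∈ laurentRing x :=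
  Subring.prod_mem _ fun i _ => zpow_mem_laurentRing x i (e i)

theorem monomialAt_ne_zero {x : W → K} (hx : ∀ i, x i ≠ 0) (e : W → ℤ) :
    monomialAt x e ≠ 0 :=
  Finset.prod_ne_zero_iff.2 fun i _ => zpow_ne_zero _ (hx i)

theorem monomialAt_add {x : W → K} (hx : ∀ i, x i ≠ 0) (e f : W → ℤ) :
    monomialAt x (e + f) = monomialAt x e * monomialAt x f := by
  simp [monomialAt, zpow_add₀ (hx _), Finset.prod_mul_distrib]

theorem monomialAt_neg (x : W → K) (e : W → ℤ) :
    monomialAt x (-e) = (monomialAt x e)⁻¹ := by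
  simp [monomialAt]

theorem monomialAt_sub {x : W → K} (hx : ∀ i, x i ≠ 0) (e f : W → ℤ) :
    monomialAt x (e - f) = monomialAt x e / monomialAt x f := by
  rw [sub_eq_add_neg, monomialAt_add hx, monomialAt_neg, div_eq_mul_inv]

theorem monomialAt_nsmul (x : W → K) (n : ℕ) (e : W → ℤ) :
    monomialAt x (n • e) = monomialAt x e ^ n := by
  simp only [monomialAt, ← Finset.prod_pow, Pi.smul_apply, nsmul_eq_mul]
  refine Finset.prod_congr rfl fun i _ => ?_
  rw [mul_comm, zpow_mul, zpow_natCast]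

theorem evalAt_single_one {x : W → K} (hx : ∀ i, x i ≠ 0) (e : W → ℤ) :
    Laurent.evalAt x hx (single e 1) = monomialAt x e := by
  simp [Laurent.evalAt_single, monomialAt]

theorem mem_laurentRing_iff {x : W → K} (hx : ∀ i, x i ≠ 0) {f : K} :
    f ∈ laurentRing x ↔ ∃ g, Laurent.evalAt x hx g = f := by
  classical
  constructor
  · have : laurentRing x ≤ (Laurent.evalAt x hx).range := by
      refine Subring.closure_le.2 ?_
      have key : ∀ (i : W) (n : ℤ), monomialAt x (Pi.single i n) = x i ^ n := by
        intro i n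
        rw [monomialAt, Finset.prod_eq_single i]
        · simp
        · intro l _ hl
          simp [hl]
        · simp
      rintro _ (⟨i, rfl⟩ | ⟨i, rfl⟩)
      · exact ⟨single (Pi.single i 1) 1, by rw [evalAt_single_one, key, zpow_one]⟩
      · exact ⟨single (Pi.single i (-1)) 1, by rw [evalAt_single_one, key, zpow_neg_one]⟩
    exact fun hf => this hf
  · rintro ⟨g, rfl⟩
    induction g using AddMonoidAlgebra.induction_linear with
    | zero => simp
    | add f g hf hg => rw [map_add]; exact Subring.add_mem _ hf hg
    | single e c =>
      rw [Laurent.evalAt_single]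
      exact Subring.mul_mem _ (intCast_mem _ c) (monomialAt_mem x e)

/-- A grading for which the first binomial is homogeneous and the second is not serves as a
substitute for coprimality; injectivity transfers the statement from Laurent polynomials to the
field. -/
theorem isRegularMod_binomial {x : W → K} (hx : ∀ i, x i ≠ 0)
    (hinj : Function.Injective (Laurent.evalAt x hx)) (φ : (W → ℤ) →+ ℤ) {a b c d : W → ℤ}
    (hab : φ a = φ b) (hcd : φ c ≠ φ d) :
    IsRegularMod (laurentRing x) (monomialAt x a + monomialAt x b)
      (monomialAt x c + monomialAt x d) := by
  intro g hg h hh e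
  obtain ⟨g, rfl⟩ := (mem_laurentRing_iff hx).1 hg
  obtain ⟨h, rfl⟩ := (mem_laurentRing_iff hx).1 hh
  simp only [← evalAt_single_one hx, ← map_add, ← map_mul] at e
  obtain ⟨h', hh'⟩ := Laurent.dvd_of_dvd_binomial_mul φ hab hcd (Dvd.intro _ (hinj e).symm)
  refine ⟨_, (mem_laurentRing_iff hx).2 ⟨h', rfl⟩, ?_⟩
  simp only [← evalAt_single_one hx, ← map_add, ← map_mul, hh']

variable [DecidableEq W]

theorem monomialAt_update (x : W → K) (k : W) (y : K) (e : W → ℤ) :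
    monomialAt (Function.update x k y) e = y ^ e k * monomialAt x (Function.update e k 0) :=
  Laurent.prod_update_zpow x k y e

theorem monomialAt_update_of_eq_zero (x : W → K) {k : W} (y : K) {e : W → ℤ} (h : e k = 0) :
    monomialAt (Function.update x k y) e = monomialAt x e := by
  rw [monomialAt_update, h, zpow_zero, one_mul, ← h, Function.update_eq_self]

theorem monomialAt_split (x : W → K) (k : W) (e : W → ℤ) :
    monomialAt x e = x k ^ e k * monomialAt x (Function.update e k 0) := by
  rw [← monomialAt_update, Function.update_eq_self]

theorem monomialAt_single (x : W → K) (i : W) (n : ℤ) :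
    monomialAt x (Pi.single i n) = x i ^ n := by
  rw [monomialAt_split x i]
  simp [Pi.single, monomialAt]

end LaurentRing

/-! ### Seeds with integer exchange matrices -/

section Mutation

variable {W : Type u} {K : Type*} [Field K]

/-- The exponents of the monomial of incoming arrows in the exchange polynomial. -/
def inExponent (b : W → W → ℤ) (k : W) : W → ℤ := fun i => ((b i k).toNat : ℤ)

theorem inExponent_apply (b : W → W → ℤ) (k i : W) : inExponent b k i = (b i k).toNat := rfl

theorem inExponent_sub_neg (b : W → W → ℤ) (k : W) (i : W) :
    inExponent b k i - inExponent (-b) k i = b i k := by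
  simp only [inExponent, Pi.neg_apply]
  omega

theorem inExponent_of_nonpos {b : W → W → ℤ} {i k : W} (h : b i k ≤ 0) :
    inExponent b k i = 0 := by
  simp only [inExponent]
  omega

/-- Mutation at `k` of an exchange matrix. -/
def mutateMatrix [DecidableEq W] (b : W → W → ℤ) (k : W) : W → W → ℤ := fun i j =>
  if i = k ∨ j = k then -b i j
  else b i j + (b i k).toNat * (b k j).toNat - (-b i k).toNat * (-b k j).toNat

theorem mutateMatrix_neg [DecidableEq W] (b : W → W → ℤ) (k : W) :
    mutateMatrix (-b) k = -mutateMatrix b k := by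
  funext i j
  simp only [mutateMatrix, Pi.neg_apply, neg_neg]
  split_ifs <;> ring

variable [Fintype W]

/-- The exchange polynomial at `k`, evaluated at a cluster. -/
def exchange (b : W → W → ℤ) (x : W → K) (k : W) : K :=
  monomialAt x (inExponent b k) + monomialAt x (inExponent (-b) k)

theorem exchange_neg (b : W → W → ℤ) (x : W → K) (k : W) :
    exchange (-b) x k = exchange b x k := by
  rw [exchange, exchange, neg_neg, add_comm]

theorem exchange_mem (b : W → W → ℤ) (x : W → K) (k : W) : exchange b x k ∈ laurentRing x :=
  Subring.add_mem _ (monomialAt_mem x _) (monomialAt_mem x _)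

variable [DecidableEq W]

/-- Mutation at `k` of a cluster. -/
def mutateCluster (b : W → W → ℤ) (x : W → K) (k : W) : W → K :=
  Function.update x k (exchange b x k / x k)

theorem mutateCluster_neg (b : W → W → ℤ) (x : W → K) (k : W) :
    mutateCluster (-b) x k = mutateCluster b x k := by
  rw [mutateCluster, mutateCluster, exchange_neg]

theorem exchange_update {b : W → W → ℤ} {k : W} (x : W → K) {j : W} (y : K) (h : b j k = 0) :
    exchange b (Function.update x j y) k = exchange b x k := by
  rw [exchange, exchange, monomialAt_update_of_eq_zero, monomialAt_update_of_eq_zero] <;>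
  simp [inExponent, h]

theorem exchange_mutateMatrix_self (b : W → W → ℤ) (x : W → K) (k : W) :
    exchange (mutateMatrix b k) x k = exchange b x k := by
  rw [← exchange_neg b]
  have : inExponent (mutateMatrix b k) k = inExponent (-b) k := by
    funext i; simp [inExponent, mutateMatrix]
  have h2 : inExponent (-mutateMatrix b k) k = inExponent b k := by
    funext i; simp [inExponent, mutateMatrix]
  rw [exchange, exchange, this, h2, neg_neg]

theorem mutateCluster_mutateCluster {b : W → W → ℤ} {x : W → K} {k : W} (hb : b k k = 0)
    (hx : exchange b x k ≠ 0) :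
    mutateCluster (mutateMatrix b k) (mutateCluster b x k) k = x := by
  rw [mutateCluster, exchange_mutateMatrix_self, mutateCluster, exchange_update x _ hb,
    Function.update_self, Function.update_idem, div_div_cancel₀ hx, Function.update_eq_self]

end Mutation

/-! ### Membership in the Laurent rings of neighbouring seeds -/

section Exchange

variable {W : Type u} {K : Type*} [Field K] [Fintype W] [DecidableEq W]

/-- Only x_j changes, and x_j = P_j / x_j' while P_j x_j⁻¹ = x_j'. -/
theorem exists_pow_exchange_mul_mem {b : W → W → ℤ} {x : W → K} {j : W} (hb : b j j = 0)
    (hx : ∀ i, x i ≠ 0) (hE : exchange b x j ≠ 0) {f : K} (hf : f ∈ laurentRing x) :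
    ∃ n : ℕ, exchange b x j ^ n * f ∈ laurentRing (mutateCluster b x j) := by
  have hD : exchange b x j ∈ laurentRing (mutateCluster b x j) := by
    rw [← exchange_update x _ hb]
    exact exchange_mem _ _ _
  have hj := mem_laurentRing (mutateCluster b x j) j
  have hj' := inv_mem_laurentRing (mutateCluster b x j) j
  rw [mutateCluster, Function.update_self, ← mutateCluster] at hj hj'
  refine exists_pow_mul_mem hD (fun i => ?_) (fun i => ?_) hf
  · by_cases h : i = j
    · subst h
      refine ⟨0, ?_⟩
      have : exchange b x i ^ 0 * x i = exchange b x i * (exchange b x i / x i)⁻¹ := by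
        have := hx i
        field_simp
      rw [this]
      exact Subring.mul_mem _ hD hj'
    · have := mem_laurentRing (mutateCluster b x j) i
      rw [mutateCluster, Function.update_of_ne h, ← mutateCluster] at this
      exact ⟨0, by simpa using this⟩
  · by_cases h : i = j
    · subst h
      exact ⟨1, by simpa [div_eq_mul_inv] using hj⟩
    · have := inv_mem_laurentRing (mutateCluster b x j) i
      rw [mutateCluster, Function.update_of_ne h, ← mutateCluster] at this
      exact ⟨0, by simpa using this⟩

/-- The exchange step at two vertices which are not connected. -/
theorem mem_laurentRing_of_eq_zero {b : W → W → ℤ} {x : W → K} {j k : W} (hjk : j ≠ k)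
    (hjj : b j j = 0) (hb : b j k = 0) (hb' : b k j = 0)
    (hx : ∀ i, x i ≠ 0) (hj : exchange b x j ≠ 0) (hk : exchange b x k ≠ 0)
    (hx' : ∀ i, mutateCluster b x j i ≠ 0)
    (hinj : Function.Injective (Laurent.evalAt _ hx'))
    (hφ : ∃ φ : (W → ℤ) →+ ℤ, φ (fun i => b i j) = 0 ∧ φ (fun i => b i k) ≠ 0) {f : K}
    (hf : f ∈ laurentRing x)
    (hf' : f ∈ laurentRing (mutateCluster (mutateMatrix b k) (mutateCluster b x k) j)) :
    f ∈ laurentRing (mutateCluster b x j) := by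
  obtain ⟨φ, hφj, hφk⟩ := hφ
  have hsub : ∀ l, φ (inExponent b l) - φ (inExponent (-b) l) = φ (fun i => b i l) := by
    intro l
    rw [← map_sub]
    exact congrArg φ (funext (inExponent_sub_neg b l))
  have hEk : exchange b (mutateCluster b x j) k = exchange b x k := exchange_update _ _ hb
  have hEj : exchange b (mutateCluster b x j) j = exchange b x j := exchange_update _ _ hjj
  obtain ⟨n, hn⟩ := exists_pow_exchange_mul_mem hjj hx hj hf
  have hkS := exchange_mem b (mutateCluster b x j) k
  have hjS := exchange_mem b (mutateCluster b x j) j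
  rw [hEk] at hkS
  rw [hEj] at hjS
  have hreg : IsRegularMod (laurentRing (mutateCluster b x j)) (exchange b x j)
      (exchange b x k) := by
    rw [← hEk, ← hEj]
    refine isRegularMod_binomial hx' hinj φ ?_ ?_
    · have := hsub j
      omega
    · have := hsub k
      omega
  -- As j and k are not connected, mutation at k leaves the exchange polynomial at j unchanged. Thus
  -- the clusters obtained by mutating at j, with or without a previous mutation at k, differ only
  -- in the entry at k.
  have hcol : ∀ i, mutateMatrix b k i j = b i j := by
    intro i
    by_cases h : i = k
    · subst h; simp [mutateMatrix, hb']
    · simp [mutateMatrix, h, hjk, hb']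
  have hjx : exchange (mutateMatrix b k) (mutateCluster b x k) j = exchange b x j := by
    rw [mutateCluster, exchange_update _ _ (by rw [hcol, hb'])]
    have h1 : inExponent (mutateMatrix b k) j = inExponent b j := by
      funext i; simp only [inExponent, hcol]
    have h2 : inExponent (-mutateMatrix b k) j = inExponent (-b) j := by
      funext i; simp only [inExponent, Pi.neg_apply, hcol]
    rw [exchange, exchange, h1, h2]
  suffices h : ∃ m : ℕ, exchange b x k ^ m * f ∈ laurentRing (mutateCluster b x j) by
    obtain ⟨m, hm⟩ := h
    exact mem_of_isRegularMod hj hkS hreg hm hn hjS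
  have hmem := mem_laurentRing (mutateCluster b x j)
  have hinv := inv_mem_laurentRing (mutateCluster b x j)
  have hxk : mutateCluster b x j k = x k := Function.update_of_ne hjk.symm _ _
  have hval : ∀ i, i ≠ k → mutateCluster (mutateMatrix b k) (mutateCluster b x k) j i =
      mutateCluster b x j i := by
    intro i hi
    by_cases h : i = j
    · subst h
      rw [mutateCluster, Function.update_self, hjx, mutateCluster, mutateCluster,
        Function.update_self, Function.update_of_ne hi]
    · simp [mutateCluster, h, hi]
  have hvalk : mutateCluster (mutateMatrix b k) (mutateCluster b x k) j k =
      exchange b x k / x k := by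
    simp [mutateCluster, hjk.symm]
  refine exists_pow_mul_mem hkS (fun i => ?_) (fun i => ?_) hf'
  · by_cases h : i = k
    · refine ⟨0, ?_⟩
      rw [h, hvalk, pow_zero, one_mul, div_eq_mul_inv, ← hxk]
      exact Subring.mul_mem _ hkS (hinv k)
    · exact ⟨0, by rw [hval i h, pow_zero, one_mul]; exact hmem i⟩
  · by_cases h : i = k
    · refine ⟨1, ?_⟩
      rw [h, hvalk, pow_one, inv_div, mul_div_cancel₀ _ hk, ← hxk]
      exact hmem k
    · exact ⟨0, by rw [hval i h, pow_zero, one_mul]; exact hinv i⟩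

end Exchange

/-! ### The exchange step at two connected vertices -/

section Exchange

/-- The result of three successive exchanges at two connected vertices. -/
theorem eq_of_exchange_relations {K : Type*} [Field K] {y y' y'' z X U V p q p' q' w : K} {n : ℕ}
    (hn : n ≠ 0) (hy : y ≠ 0) (hz : z ≠ 0) (h1 : y * y'' = p + z ^ n * q)
    (h2 : X * z = y ^ n * V + U) (h3 : y' * y = X ^ n * q' + p') (h4 : q * w = p')
    (h5 : p * w = q' * U ^ n) :
    y' = w * z⁻¹ ^ n * y'' +
      q' * (∑ i ∈ Finset.range n, X ^ i * (U * z⁻¹) ^ (n - 1 - i)) * V * z⁻¹ * y ^ (n - 1) := by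
  -- X agrees with U / z up to a multiple of y^n, hence so do their n-th powers. The remaining terms
  -- of y' y combine, by `h4` and `h5`, to a multiple of p + z^n q = y y'', so that y can be
  -- cancelled.
  have hX : X - U * z⁻¹ = y ^ n * V * z⁻¹ := by
    have : X = (y ^ n * V + U) * z⁻¹ := by rw [← h2]; field_simp
    rw [this]; ring
  have hg := geom_sum₂_mul X (U * z⁻¹) n
  set G := ∑ i ∈ Finset.range n, X ^ i * (U * z⁻¹) ^ (n - 1 - i)
  have hX' : X ^ n = G * (y ^ n * V * z⁻¹) + (U * z⁻¹) ^ n := by rw [← hX, hg]; ring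
  have hyn : y ^ n = y ^ (n - 1) * y := (pow_sub_one_mul hn y).symm
  have hzn : z⁻¹ ^ n * z ^ n = 1 := by rw [← mul_pow, inv_mul_cancel₀ hz, one_pow]
  refine mul_right_cancel₀ hy ?_
  calc y' * y = q' * G * V * z⁻¹ * y ^ n + (q' * U ^ n) * z⁻¹ ^ n + p' := by
        rw [h3, hX', mul_pow]; ring
    _ = q' * G * V * z⁻¹ * y ^ n + w * z⁻¹ ^ n * p + (z⁻¹ ^ n * z ^ n) * (q * w) := by
        rw [← h5, ← h4, hzn]; ring
    _ = q' * G * V * z⁻¹ * y ^ n + w * z⁻¹ ^ n * (y * y'') := by rw [h1]; ring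
    _ = _ := by rw [hyn]; ring

variable {W : Type u} {K : Type*} [Field K] [Fintype W] [DecidableEq W]

/-- The exchange step at two vertices which are connected by arrows from the first one to the
second one. -/
theorem mem_laurentRing_of_pos {b : W → W → ℤ} {x : W → K} {j k : W} (hjk : j ≠ k)
    (hjj : b j j = 0) (hkk : b k k = 0) (hb : 0 < b j k) (hb' : b k j = -b j k)
    (hx : ∀ i, x i ≠ 0) (hj : exchange b x j ≠ 0)
    (hx' : ∀ i, mutateCluster b x j i ≠ 0)
    (hx2 : ∀ i, mutateCluster (mutateMatrix b k) (mutateCluster b x k) j i ≠ 0)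
    (hinj : Function.Injective (Laurent.evalAt _ hx')) {f : K}
    (hf : f ∈ laurentRing x)
    (hf' : f ∈ laurentRing (mutateCluster (mutateMatrix b k) (mutateCluster b x k) j)) :
    f ∈ laurentRing (mutateCluster b x j) := by
  obtain ⟨n, hbn⟩ : ∃ n : ℕ, b j k = n := ⟨(b j k).toNat, by omega⟩
  have hn : n ≠ 0 := by omega
  set S := laurentRing (mutateCluster b x j) with hS
  set b' := mutateMatrix b k with hb1
  have hb'jj : b' j j = 0 := by
    simp [hb1, mutateMatrix, hjk, hjj, hb', hbn]
  have hb'kj : b' k j = n := by simp [hb1, mutateMatrix, hb', hbn]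
  have hb'ij : ∀ i, i ≠ k → b' i j = b i j - (-b i k).toNat * n := by
    intro i hi
    simp [hb1, mutateMatrix, hi, hjk, hb', hbn]
  -- the exponents of the monomials in the exchange relations
  set eU := inExponent (-b) k with heU
  set eV := Function.update (inExponent b k) j 0 with heV
  set ep := inExponent b j with hep
  set er := Function.update (inExponent (-b) j) k 0 with her
  set ep' := inExponent (-b') j with hep'
  set er' := Function.update (inExponent b' j) k 0 with her'
  have hUj : eU j = 0 := inExponent_of_nonpos (by simp only [Pi.neg_apply]; omega)
  have hUk : eU k = 0 := inExponent_of_nonpos (by simp only [Pi.neg_apply]; omega)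
  have hVj : eV j = 0 := Function.update_self ..
  have hpj : ep j = 0 := inExponent_of_nonpos (by omega)
  have hpk : ep k = 0 := inExponent_of_nonpos (by omega)
  have hqj : er j = 0 := by
    rw [her, Function.update_of_ne hjk]
    exact inExponent_of_nonpos (by simp only [Pi.neg_apply]; omega)
  have hqk : er k = 0 := Function.update_self ..
  have hp'j : ep' j = 0 := inExponent_of_nonpos (by simp only [Pi.neg_apply]; omega)
  have hp'k : ep' k = 0 := inExponent_of_nonpos (by simp only [Pi.neg_apply]; omega)
  have hq'j : er' j = 0 := by
    rw [her', Function.update_of_ne hjk]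
    exact inExponent_of_nonpos (by omega)
  have hq'k : er' k = 0 := Function.update_self ..
  -- This is the mutation rule b'_ij = b_ij - n [-b_ik]_+ for i ≠ k, read as an identity of
  -- exponents; the entries at k have been stripped off.
  have hexp : ep + (ep' - er) = er' + n • eU := by
    funext i
    have hs : (n • eU) i = n * eU i := by simp
    simp only [Pi.add_apply, Pi.sub_apply, hs]
    by_cases hi : i = k
    · rw [hi, hpk, hp'k, hqk, hq'k, hUk]; simp
    · have h1 : ep i - er i = b i j := by
        rw [her, Function.update_of_ne hi, hep, inExponent_sub_neg]
      have h2 : er' i - ep' i = b' i j := by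
        rw [her', Function.update_of_ne hi, hep', inExponent_sub_neg]
      have h3 : eU i = (-b i k).toNat := rfl
      have h4 := hb'ij i hi
      rw [← h3] at h4
      linarith
  -- the exchange relations
  have hE : exchange b x k = x j ^ n * monomialAt x eV + monomialAt x eU := by
    rw [exchange, monomialAt_split x j (inExponent b k), inExponent_apply, hbn, Int.toNat_natCast,
      zpow_natCast]
  have hD : exchange b x j = monomialAt x ep + x k ^ n * monomialAt x er := by
    rw [exchange, monomialAt_split x k (inExponent (-b) j), inExponent_apply, Pi.neg_apply,
      Pi.neg_apply, hb', neg_neg, hbn, Int.toNat_natCast, zpow_natCast]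
  set X := exchange b x k / x k with hX
  have hE' : exchange b' (mutateCluster b x k) j =
      X ^ n * monomialAt x er' + monomialAt x ep' := by
    rw [exchange, mutateCluster, monomialAt_update, inExponent_apply, hb'kj, Int.toNat_natCast,
      zpow_natCast, monomialAt_update_of_eq_zero x _ hp'k]
  set y' := exchange b' (mutateCluster b x k) j / x j with hy'
  set y'' := exchange b x j / x j with hy''
  have hval : mutateCluster b' (mutateCluster b x k) j =
      Function.update (Function.update x k X) j y' := by
    rw [mutateCluster, mutateCluster, Function.update_of_ne hjk, ← mutateCluster]
  have hX0 : X ≠ 0 := by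
    have := hx2 k
    rwa [hval, Function.update_of_ne hjk.symm, Function.update_self] at this
  have hy'0 : y' ≠ 0 := by
    have := hx2 j
    rwa [hval, Function.update_self] at this
  have hy''0 : y'' ≠ 0 := div_ne_zero hj (hx j)
  set w := monomialAt x (ep' - er) with hw
  have hrel := eq_of_exchange_relations (y' := y') (y'' := y'') (X := X) (w := w) hn (hx j) (hx k)
    (by rw [← hD, hy'', mul_div_cancel₀ _ (hx j)])
    (by rw [← hE, hX, div_mul_cancel₀ _ (hx k)])
    (by rw [← hE', hy', div_mul_cancel₀ _ (hx j)])
    (by rw [hw, ← monomialAt_add hx, add_sub_cancel])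
    (by rw [hw, ← monomialAt_add hx, hexp, monomialAt_add hx, monomialAt_nsmul])
  -- membership in the Laurent ring of the mutation at `j`
  have hmono : ∀ e : W → ℤ, e j = 0 → monomialAt (mutateCluster b x j) e = monomialAt x e :=
    fun e he => monomialAt_update_of_eq_zero x _ he
  have hmS : ∀ e : W → ℤ, e j = 0 → monomialAt x e ∈ S := by
    intro e he
    rw [← hmono e he]
    exact monomialAt_mem _ _
  have hzx : mutateCluster b x j k = x k := Function.update_of_ne hjk.symm _ _
  have hyx : mutateCluster b x j j = y'' := Function.update_self ..
  have hzS : (x k)⁻¹ ∈ S := by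
    rw [← hzx]; exact inv_mem_laurentRing _ _
  have hy''S : y'' ∈ S := by
    rw [← hyx]; exact mem_laurentRing _ _
  have hy''S' : y''⁻¹ ∈ S := by
    rw [← hyx]; exact inv_mem_laurentRing _ _
  have hDS : exchange b x j ∈ S := by
    rw [← exchange_update x _ hjj]
    exact exchange_mem _ _ _
  have hyD : x j = exchange b x j * y''⁻¹ := by
    rw [hy'', inv_div, mul_div_cancel₀ _ hj]
  have hyS : x j ∈ S := by
    rw [hyD]; exact S.mul_mem hDS hy''S'
  have hUS := hmS eU hUj
  have hVS := hmS eV hVj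
  have hwj : (ep' - er) j = 0 := by rw [Pi.sub_apply, hp'j, hqj, sub_zero]
  -- Since x_j = P_j / y'' and n > 0, the new variable X is a unit of `S` modulo P_j.
  have hXeq : X = monomialAt x eU * (x k)⁻¹ +
      exchange b x j * (y''⁻¹ * x j ^ (n - 1) * monomialAt x eV * (x k)⁻¹) := by
    have h1 : exchange b x j * (y''⁻¹ * x j ^ (n - 1) * monomialAt x eV * (x k)⁻¹) =
        (x j ^ (n - 1) * x j) * monomialAt x eV * (x k)⁻¹ := by
      linear_combination (-(x j ^ (n - 1) * monomialAt x eV * (x k)⁻¹)) * hyD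
    rw [h1, pow_sub_one_mul hn, hX, hE]; ring
  have hsX : y''⁻¹ * x j ^ (n - 1) * monomialAt x eV * (x k)⁻¹ ∈ S :=
    S.mul_mem (S.mul_mem (S.mul_mem hy''S' (S.pow_mem hyS _)) hVS) hzS
  have hXS : X ∈ S := by
    rw [hXeq]
    exact S.add_mem (S.mul_mem hUS hzS) (S.mul_mem hDS hsX)
  have hXreg : IsRegularMod S (exchange b x j) X := by
    refine isRegularMod_of_eq_unit_add
      (mul_ne_zero (monomialAt_ne_zero hx eU) (inv_ne_zero (hx k))) ?_ hsX hXeq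
    rw [mul_inv, inv_inv, ← monomialAt_neg]
    refine S.mul_mem (hmS _ (by simp [hUj])) ?_
    rw [← hzx]
    exact mem_laurentRing _ _
  set G := ∑ i ∈ Finset.range n, X ^ i * (monomialAt x eU * (x k)⁻¹) ^ (n - 1 - i) with hG
  have hGS : G ∈ S := S.sum_mem fun i _ =>
    S.mul_mem (S.pow_mem hXS _) (S.pow_mem (S.mul_mem hUS hzS) _)
  have hcS : monomialAt x er' * G * monomialAt x eV * (x k)⁻¹ ∈ S :=
    S.mul_mem (S.mul_mem (S.mul_mem (hmS _ hq'j) hGS) hVS) hzS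
  have hy'S : y' ∈ S := by
    rw [hrel]
    exact S.add_mem (S.mul_mem (S.mul_mem (hmS _ hwj) (S.pow_mem hzS _)) hy''S)
      (S.mul_mem hcS (S.pow_mem hyS _))
  have hy'reg : IsRegularMod S (exchange b x j) y' := by
    by_cases h1 : n = 1
    · -- both terms are monomials, of different degrees in the new variable
      have hG1 : G = 1 := by rw [hG, h1]; simp
      have hy'er : y' = monomialAt (mutateCluster b x j) (ep' - er - Pi.single k 1 + Pi.single j 1)
          + monomialAt (mutateCluster b x j) (er' + eV - Pi.single k 1) := by
        rw [monomialAt_add hx', monomialAt_sub hx' (ep' - er), monomialAt_sub hx' (er' + eV),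
          monomialAt_add hx',
          monomialAt_single, monomialAt_single, hzx, hyx, zpow_one, zpow_one, hmono _ hwj,
          hmono _ hq'j, hmono _ hVj, hrel, hG1, h1]
        simp [hw, div_eq_mul_inv]
      have hDeq : exchange b x j = exchange b (mutateCluster b x j) j :=
        (exchange_update x _ hjj).symm
      rw [hy'er, hDeq, hS, exchange]
      refine isRegularMod_binomial hx' hinj (Pi.evalAddMonoidHom (fun _ => ℤ) j) ?_ ?_
      · simp [inExponent, hjj]
      · simp [hp'j, hqj, hq'j, hVj, hjk]
    -- For n ≥ 2 the second term of `hrel` contains x_j^(n-1), hence a factor P_j, so y' is a unit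
    -- modulo P_j.
    · obtain ⟨m, rfl⟩ : ∃ m, n = m + 2 := ⟨n - 2, by omega⟩
      refine isRegularMod_of_eq_unit_add (u := w * (x k)⁻¹ ^ (m + 2) * y'')
        (s := monomialAt x er' * G * monomialAt x eV * (x k)⁻¹ * (y''⁻¹ * x j ^ m)) ?_ ?_ ?_ ?_
      · exact mul_ne_zero (mul_ne_zero (monomialAt_ne_zero hx _)
          (pow_ne_zero _ (inv_ne_zero (hx k)))) hy''0
      · rw [mul_inv, mul_inv, ← inv_pow, inv_inv, hw, ← monomialAt_neg]
        refine S.mul_mem (S.mul_mem (hmS _ (by rw [Pi.neg_apply, hwj, neg_zero])) ?_) hy''S'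
        refine S.pow_mem ?_ _
        rw [← hzx]
        exact mem_laurentRing _ _
      · exact S.mul_mem hcS (S.mul_mem hy''S' (S.pow_mem hyS _))
      · have h2 : x j ^ (m + 2 - 1) = exchange b x j * y''⁻¹ * x j ^ m := by
          rw [← hyD, show m + 2 - 1 = m + 1 from rfl, pow_succ']
        rw [hrel, h2]
        ring
  obtain ⟨N, hN⟩ := exists_pow_exchange_mul_mem hjj hx hj hf
  -- The entries of the doubly mutated cluster lie in `S`, and only X and y' may fail to be
  -- invertible there, so powers of X y' clear all denominators.
  have hrS : X * y' ∈ S := S.mul_mem hXS hy'S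
  suffices h : ∃ m : ℕ, (X * y') ^ m * f ∈ S by
    obtain ⟨m, hm⟩ := h
    exact mem_of_isRegularMod hj hrS (hXreg.mul hy'S hy'reg) hm hN hDS
  rw [hval] at hf'
  refine exists_pow_mul_mem hrS (fun i => ?_) (fun i => ?_) hf'
  · refine ⟨0, ?_⟩
    rw [pow_zero, one_mul]
    by_cases hij : i = j
    · rw [hij, Function.update_self]; exact hy'S
    · rw [Function.update_of_ne hij]
      by_cases hik : i = k
      · rw [hik, Function.update_self]; exact hXS
      · rw [Function.update_of_ne hik]
        have := mem_laurentRing (mutateCluster b x j) i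
        rwa [mutateCluster, Function.update_of_ne hij, ← mutateCluster] at this
  · by_cases hij : i = j
    · refine ⟨1, ?_⟩
      rw [hij, Function.update_self, pow_one, mul_inv_cancel_right₀ hy'0]; exact hXS
    · rw [Function.update_of_ne hij]
      by_cases hik : i = k
      · refine ⟨1, ?_⟩
        rw [hik, Function.update_self, pow_one, mul_comm X, mul_inv_cancel_right₀ hX0]
        exact hy'S
      · refine ⟨0, ?_⟩
        rw [Function.update_of_ne hik, pow_zero, one_mul]
        have := inv_mem_laurentRing (mutateCluster b x j) i
        rwa [mutateCluster, Function.update_of_ne hij, ← mutateCluster] at this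

end Exchange

/-! ### The upper bound of a seed contains all cluster variables -/

section Upper

variable {W : Type u}

/-- The exchange polynomial at `k`. -/
def exchangePoly (b : W → W → ℤ) (k : W) : Laurent W :=
  single (inExponent b k) 1 + single (inExponent (-b) k) 1

theorem component_exchangePoly_mul {b : W → W → ℤ} {k : W} (hb : b k k = 0) (n : ℤ)
    (f : Laurent W) :
    Laurent.component (Pi.evalAddMonoidHom (fun _ => ℤ) k) n (exchangePoly b k * f) =
      exchangePoly b k * Laurent.component (Pi.evalAddMonoidHom (fun _ => ℤ) k) n f := by
  have h1 : inExponent b k k = 0 := inExponent_of_nonpos hb.le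
  have h2 : inExponent (-b) k k = 0 := inExponent_of_nonpos (by simp [hb])
  rw [exchangePoly, Laurent.component_binomial_mul _ (by simp [h1, h2])]
  simp [h1]

theorem mutateMatrix_skew [DecidableEq W] {b : W → W → ℤ} (h : ∀ i j, b i j = -b j i) (k i j : W) :
    mutateMatrix b k i j = -mutateMatrix b k j i := by
  simp only [mutateMatrix, or_comm (a := j = k)]
  split_ifs
  · rw [h i j]
  · rw [h i j, h j k, h k i, neg_neg, neg_neg]
    ring

variable [Fintype W]

theorem evalAt_exchangePoly {K : Type*} [Field K] {x : W → K} (hx : ∀ i, x i ≠ 0)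
    (b : W → W → ℤ) (k : W) : Laurent.evalAt x hx (exchangePoly b k) = exchange b x k := by
  rw [exchangePoly, map_add, evalAt_single_one, evalAt_single_one, exchange]

/-- Its value at the all-ones point is 2. -/
theorem exchangePoly_ne_zero (b : W → W → ℤ) (k : W) : exchangePoly b k ≠ 0 := by
  intro h
  have h1 := congrArg (Laurent.eval (1 : W → ℤˣ)) h
  simp [exchangePoly, Laurent.eval_single] at h1

/-- The exchange matrix is skew-symmetric, its columns at mutable vertices are linearly
independent, and the elements of the cluster are algebraically independent. -/
structure IsAdmissible {K : Type*} [Field K] (M : Set W) (b : W → W → ℤ) (x : W → K) :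
    Prop where
  skew : ∀ i j, b i j = -b j i
  indep : ∀ c : W → ℤ, (∀ i ∉ M, c i = 0) → (∀ i, ∑ j, b i j * c j = 0) → c = 0
  ne_zero : ∀ i, x i ≠ 0
  injective : Function.Injective (Laurent.evalAt x ne_zero)

variable {K : Type*} [Field K] {M : Set W} {b : W → W → ℤ} {x : W → K}

theorem IsAdmissible.diag (h : IsAdmissible M b x) (i : W) : b i i = 0 := by
  have := h.skew i i
  omega

theorem IsAdmissible.exchange_ne_zero (h : IsAdmissible M b x) (k : W) :
    exchange b x k ≠ 0 := by
  rw [← evalAt_exchangePoly h.ne_zero]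
  exact (map_ne_zero_iff _ h.injective).2 (exchangePoly_ne_zero b k)

theorem evalAt_congr {x y : W → K} (h : x = y) (hx : ∀ i, x i ≠ 0) (hy : ∀ i, y i ≠ 0) :
    Laurent.evalAt x hx = Laurent.evalAt y hy := by
  subst h; rfl

/-! ### Mutation of admissible seeds and invariance of upper bounds -/

variable [DecidableEq W]

/-- Matrix mutation multiplies `b` on both sides by invertible matrices. The right factor carries a
kernel vector `c` of the mutated matrix to one of `b`, replacing `c k` by `t - c k`. -/
theorem mutateMatrix_indep (hs : ∀ i j, b i j = -b j i)
    (h : ∀ c : W → ℤ, (∀ i ∉ M, c i = 0) → (∀ i, ∑ j, b i j * c j = 0) → c = 0) {k : W}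
    (hk : k ∈ M) (c : W → ℤ) (hc : ∀ i ∉ M, c i = 0)
    (hbc : ∀ i, ∑ j, mutateMatrix b k i j * c j = 0) : c = 0 := by
  have hkk : b k k = 0 := by have := hs k k; omega
  set t : ℤ := ∑ j, (b k j).toNat * c j with ht
  have hrow : ∑ j, b k j * c j = 0 := by
    have := hbc k
    simp only [mutateMatrix, true_or, if_true, neg_mul, Finset.sum_neg_distrib] at this
    omega
  have hupd : ∀ i, ∑ j, b i j * Function.update c k (t - c k) j =
      ∑ j, b i j * c j + b i k * (t - 2 * c k) := by
    intro i
    rw [← Finset.add_sum_erase _ _ (Finset.mem_univ k),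
      ← Finset.add_sum_erase _ (fun j => b i j * c j) (Finset.mem_univ k), Function.update_self]
    have : ∑ j ∈ Finset.univ.erase k, b i j * Function.update c k (t - c k) j =
        ∑ j ∈ Finset.univ.erase k, b i j * c j :=
      Finset.sum_congr rfl fun j hj => by rw [Function.update_of_ne (Finset.ne_of_mem_erase hj)]
    rw [this]
    ring
  have hd := h (Function.update c k (t - c k)) (fun i hi => by
      rw [Function.update_of_ne (ne_of_mem_of_not_mem hk hi).symm, hc i hi]) (fun i => by
    rw [hupd]
    by_cases hi : i = k
    · rw [hi, hrow, hkk]; ring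
    · have hent : ∀ j, mutateMatrix b k i j * c j = b i j * c j +
          b i k * ((b k j).toNat * c j) + (-b i k).toNat * (b k j * c j) -
          if j = k then 2 * (b i k * c k) else 0 := by
        intro j
        have h1 : ∀ a : ℤ, (a.toNat : ℤ) = a + (-a).toNat := fun a => by omega
        by_cases hj : j = k
        · subst hj
          simp only [mutateMatrix, or_true, if_true, hkk, Int.toNat_zero, Nat.cast_zero]
          ring
        · simp only [mutateMatrix, hi, hj, or_self, if_false]
          rw [h1 (b i k), h1 (b k j)]
          ring
      have h2 := hbc i
      simp only [hent, Finset.sum_sub_distrib, Finset.sum_add_distrib, ← Finset.mul_sum,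
        Finset.sum_ite_eq', Finset.mem_univ, if_true, hrow, ← ht] at h2
      rw [← h2]
      ring)
  have hne : ∀ i, i ≠ k → c i = 0 := by
    intro i hi
    have := congrFun hd i
    rwa [Function.update_of_ne hi] at this
  have ht0 : t = 0 := by
    refine Finset.sum_eq_zero fun j _ => ?_
    by_cases hj : j = k
    · rw [hj, hkk]; simp
    · rw [hne j hj, mul_zero]
  have hdk := congrFun hd k
  rw [Function.update_self, ht0, Pi.zero_apply] at hdk
  funext i
  by_cases hi : i = k
  · rw [hi, Pi.zero_apply]; omega
  · exact hne i hi

theorem mutateCluster_ne_zero (hx : ∀ i, x i ≠ 0) {k : W} (hk : exchange b x k ≠ 0) (i : W) :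
    mutateCluster b x k i ≠ 0 := by
  rw [mutateCluster]
  by_cases hi : i = k
  · rw [hi, Function.update_self]; exact div_ne_zero hk (hx k)
  · rw [Function.update_of_ne hi]; exact hx i

theorem mutateCluster_eq_update (hx : ∀ i, x i ≠ 0) (k : W) :
    mutateCluster b x k =
      Function.update x k (Laurent.evalAt x hx (exchangePoly b k) / x k) := by
  rw [evalAt_exchangePoly, mutateCluster]

theorem IsAdmissible.mutate (h : IsAdmissible M b x) {k : W} (hk : k ∈ M) :
    IsAdmissible M (mutateMatrix b k) (mutateCluster b x k) where
  skew := mutateMatrix_skew h.skew k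
  indep := mutateMatrix_indep h.skew h.indep hk
  ne_zero := mutateCluster_ne_zero h.ne_zero (h.exchange_ne_zero k)
  injective := by
    have he := mutateCluster_eq_update (b := b) h.ne_zero k
    have hx' := mutateCluster_ne_zero h.ne_zero (h.exchange_ne_zero k)
    rw [evalAt_congr he hx' (he ▸ hx')]
    exact Laurent.evalAt_update_injective x h.ne_zero h.injective k _
      (component_exchangePoly_mul (h.diag k)) _

/-- The functionals v ↦ b_qj v_p - b_pj v_q kill column j. If they all killed column k too, the 2 ×
2 minors of the two columns would vanish and the columns would be dependent. -/
theorem exists_addMonoidHom_of_indep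
    (h : ∀ c : W → ℤ, (∀ i ∉ M, c i = 0) → (∀ i, ∑ j, b i j * c j = 0) → c = 0) {j k : W}
    (hj : j ∈ M) (hk : k ∈ M) (hjk : j ≠ k) :
    ∃ φ : (W → ℤ) →+ ℤ, φ (fun i => b i j) = 0 ∧ φ (fun i => b i k) ≠ 0 := by
  by_contra! hφ
  have hdet : ∀ p q, b p k * b q j - b q k * b p j = 0 := by
    intro p q
    have := hφ ((AddMonoidHom.mulRight (b q j)).comp (Pi.evalAddMonoidHom (fun _ => ℤ) p) -
      (AddMonoidHom.mulRight (b p j)).comp (Pi.evalAddMonoidHom (fun _ => ℤ) q))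
      (by simp [mul_comm])
    simpa using this
  have hsum : ∀ (s t : ℤ) (p : W), ∑ l, b p l * (Pi.single k s + Pi.single j t : W → ℤ) l =
      b p k * s + b p j * t := by
    intro s t p
    simp [mul_add, Finset.sum_add_distrib, Pi.single_apply]
  have hsupp : ∀ s t : ℤ, ∀ i ∉ M, (Pi.single k s + Pi.single j t : W → ℤ) i = 0 := by
    intro s t i hi
    have h1 : i ≠ k := fun e => hi (e ▸ hk)
    have h2 : i ≠ j := fun e => hi (e ▸ hj)
    simp [h1, h2]
  have hcol : ∀ q, b q j = 0 := by
    intro q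
    have := congrFun (h (Pi.single k (b q j) + Pi.single j (-b q k)) (hsupp _ _) fun p => by
      rw [hsum]; linarith [hdet p q]) k
    simpa [hjk.symm] using this
  have := congrFun (h (Pi.single k 0 + Pi.single j 1) (hsupp _ _) fun p => by
    rw [hsum, hcol]; ring) j
  simp at this

/-- The exchange step at two mutable vertices. -/
theorem IsAdmissible.mem_laurentRing (h : IsAdmissible M b x) {j k : W} (hj : j ∈ M)
    (hk : k ∈ M) (hjk : j ≠ k) {f : K} (hf : f ∈ laurentRing x)
    (hf' : f ∈ laurentRing (mutateCluster (mutateMatrix b k) (mutateCluster b x k) j)) :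
    f ∈ laurentRing (mutateCluster b x j) := by
  have hx' := (h.mutate hj).ne_zero
  have hx2 := ((h.mutate hk).mutate hj).ne_zero
  rcases lt_trichotomy (b j k) 0 with hlt | h0 | hgt
  -- Reversing all arrows changes no cluster, so `-b` may replace `b`.
  · rw [← mutateCluster_neg b x k, ← neg_neg (mutateMatrix b k), mutateCluster_neg,
      ← mutateMatrix_neg] at hf' hx2
    have hinj := (h.mutate hj).injective
    rw [evalAt_congr (mutateCluster_neg b x j).symm hx' (by rwa [mutateCluster_neg])] at hinj
    rw [← mutateCluster_neg]
    exact mem_laurentRing_of_pos hjk (by simp [h.diag]) (by simp [h.diag]) (by simpa using hlt)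
      (by simp [h.skew k j]) h.ne_zero (by rw [exchange_neg]; exact h.exchange_ne_zero j) _ hx2
      hinj hf hf'
  · exact mem_laurentRing_of_eq_zero hjk (h.diag j) h0 (by rw [h.skew k j, h0, neg_zero])
      h.ne_zero (h.exchange_ne_zero j) (h.exchange_ne_zero k) hx' (h.mutate hj).injective
      (exists_addMonoidHom_of_indep h.indep hj hk hjk) hf hf'
  · exact mem_laurentRing_of_pos hjk (h.diag j) (h.diag k) hgt (h.skew k j) h.ne_zero
      (h.exchange_ne_zero j) hx' hx2 (h.mutate hj).injective hf hf'

/-- The elements which are Laurent polynomials in the given cluster and in all the clusters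
obtained from it by one mutation at a mutable vertex. -/
def upperBound (M : Set W) (b : W → W → ℤ) (x : W → K) : Set K :=
  {f | f ∈ laurentRing x ∧ ∀ j ∈ M, f ∈ laurentRing (mutateCluster b x j)}

/-- Mutation at k is an involution, so the conditions for the cluster itself and for its neighbour
at k merely change places; the exchange step handles the other neighbours. -/
theorem IsAdmissible.mem_upperBound_of_mutate (h : IsAdmissible M b x) {k : W} (hk : k ∈ M)
    {f : K} (hf : f ∈ upperBound M (mutateMatrix b k) (mutateCluster b x k)) :
    f ∈ upperBound M b x := by
  have h0 : f ∈ laurentRing x := by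
    have := hf.2 k hk
    rwa [mutateCluster_mutateCluster (h.diag k) (h.exchange_ne_zero k)] at this
  refine ⟨h0, fun j hj => ?_⟩
  by_cases hjk : j = k
  · rw [hjk]; exact hf.1
  · exact h.mem_laurentRing hj hk hjk h0 (hf.2 j hj)

/-- The cluster obtained by a sequence of mutations. -/
def iterCluster (b : W → W → ℤ) (x : W → K) : List W → W → K
  | [] => x
  | k :: ks => iterCluster (mutateMatrix b k) (mutateCluster b x k) ks

/-- The elements of the last cluster lie in its own upper bound, by x_v = P_v / x_v', and are
carried back one mutation at a time. -/
theorem IsAdmissible.iterCluster_mem_upperBound {ks : List W} (hks : ∀ k ∈ ks, k ∈ M)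
    {b : W → W → ℤ} {x : W → K} (h : IsAdmissible M b x) (v : W) :
    iterCluster b x ks v ∈ upperBound M b x := by
  induction ks generalizing b x with
  | nil =>
    refine ⟨ClusterAlg.mem_laurentRing x v, fun j hj => ?_⟩
    change x v ∈ _
    by_cases hv : v = j
    · subst hv
      have h1 := exchange_mem b (mutateCluster b x v) v
      have h2 := inv_mem_laurentRing (mutateCluster b x v) v
      rw [mutateCluster, exchange_update x _ (h.diag v), ← mutateCluster] at h1
      have h3 : x v = exchange b x v * (mutateCluster b x v v)⁻¹ := by
        rw [mutateCluster, Function.update_self, inv_div,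
          mul_div_cancel₀ _ (h.exchange_ne_zero v)]
      rw [h3]
      exact Subring.mul_mem _ h1 h2
    · have := ClusterAlg.mem_laurentRing (mutateCluster b x j) v
      rwa [mutateCluster, Function.update_of_ne hv, ← mutateCluster] at this
  | cons k ks ih =>
    have hk := hks k List.mem_cons_self
    exact h.mem_upperBound_of_mutate hk
      (ih (fun l hl => hks l (List.mem_cons_of_mem k hl)) (h.mutate hk))

end Upper

/-! ### Specialisation of Laurent polynomials -/

section Specialise

variable {V : Type u}

namespace Laurent

theorem IsPolynomialIn.add {f g : Laurent V} {j : V} (hf : f.IsPolynomialIn j)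
    (hg : g.IsPolynomialIn j) : (f + g).IsPolynomialIn j := by
  intro e he
  by_contra hlt
  refine he ?_
  have h1 : f.coeff e = 0 := by by_contra h; exact hlt (hf e h)
  have h2 : g.coeff e = 0 := by by_contra h; exact hlt (hg e h)
  rw [coeff_add, Finsupp.add_apply, h1, h2, add_zero]

theorem isPolynomialIn_single {j : V} {e : V → ℤ} (he : 0 ≤ e j) (c : ℤ) :
    IsPolynomialIn (single e c : Laurent V) j := by
  classical
  intro e' he'
  rw [coeff_single, Finsupp.single_apply] at he'
  by_cases h : e = e'
  · rwa [← h]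
  · rw [if_neg h] at he'; exact absurd rfl he'

theorem IsPolynomialIn.mul {f g : Laurent V} {j : V} (hf : f.IsPolynomialIn j)
    (hg : g.IsPolynomialIn j) : (f * g).IsPolynomialIn j := by
  classical
  intro e he
  obtain ⟨a, ha, b, hb, rfl⟩ :=
    Finset.mem_add.1 (AddMonoidAlgebra.support_coeff_mul_subset f g (Finsupp.mem_support_iff.2 he))
  exact add_nonneg (hf a (Finsupp.mem_support_iff.1 ha)) (hg b (Finsupp.mem_support_iff.1 hb))

/-- The Laurent polynomials which are polynomial in `x_j`. -/
def polynomialSubring (j : V) : Subring (Laurent V) where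
  carrier := {f | f.IsPolynomialIn j}
  zero_mem' := fun e he => absurd rfl he
  one_mem' := isPolynomialIn_single (j := j) (e := 0) le_rfl 1
  add_mem' := IsPolynomialIn.add
  mul_mem' := IsPolynomialIn.mul
  neg_mem' := fun {f} hf e he => hf e fun h => he (by rw [coeff_neg, Finsupp.neg_apply, h, neg_zero])

/-- The units `± ∏_v x_v ^ e_v` of the ring of Laurent polynomials. -/
def unitHom (V : Type u) : ℤˣ × Multiplicative (V → ℤ) →* (Laurent V)ˣ :=
  ((singleHom (R := ℤ) (M := V → ℤ)).comp
    (MonoidHom.prodMap (Units.coeHom ℤ) (MonoidHom.id _))).toHomUnits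

theorem coe_unitHom (a : ℤˣ) (e : V → ℤ) :
    ((unitHom V (a, Multiplicative.ofAdd e) : (Laurent V)ˣ) : Laurent V) = single e (a : ℤ) :=
  rfl

end Laurent

theorem single_add_single_eq_zero_iff {e f : V → ℤ} (a b : ℤˣ) :
    (single e (a : ℤ) + single f (b : ℤ) : Laurent V) = 0 ↔ e = f ∧ a * b = -1 := by
  have hab : (a : ℤ) + b = 0 ↔ a * b = -1 := by
    rcases Int.units_eq_one_or a with rfl | rfl <;> rcases Int.units_eq_one_or b with rfl | rfl <;>
    decide
  rw [← hab]
  constructor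
  · intro h
    by_cases hef : e = f
    · refine ⟨hef, ?_⟩
      rw [hef, ← single_add] at h
      exact single_eq_zero.1 h
    · have := congrArg (fun p => p.coeff e) h
      simp [Ne.symm hef] at this
  · rintro ⟨rfl, h⟩
    rw [← single_add, h, single_zero]

/-- The sign of the value of the specialisation at a monomial. -/
def Labelling.sign [Fintype V] (σ : Labelling V) (e : V → ℤ) : ℤˣ := ∏ v, (σ v).getD 1 ^ e v

theorem Labelling.sign_natCast [Fintype V] (σ : Labelling V) (m : V → ℕ) :
    σ.sign (fun v => (m v : ℤ)) = (-1) ^ ∑ v with σ v = some (-1), m v := by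
  rw [← Finset.prod_pow_eq_pow_sum, Finset.prod_filter, Labelling.sign]
  refine Finset.prod_congr rfl fun v _ => ?_
  rw [zpow_natCast]
  rcases h : σ v with _ | a
  · simp
  · rcases Int.units_eq_one_or a with rfl | rfl
    · have : ¬ (some (1 : ℤˣ) = some (-1)) := by decide
      simp [this]
    · simp

theorem Labelling.sign_add [Fintype V] (σ : Labelling V) (e f : V → ℤ) :
    σ.sign (e + f) = σ.sign e * σ.sign f := by
  simp [Labelling.sign, zpow_add, Finset.prod_mul_distrib]

variable [DecidableEq V]

theorem Labelling.value_eq (σ : Labelling V) (v : V) :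
    σ.value v = Laurent.unitHom σ.Free
      ((σ v).getD 1, Multiplicative.ofAdd fun i => if i.1 = v then 1 else 0) := by
  apply Units.ext
  rw [Laurent.coe_unitHom, Labelling.value]
  split
  · next h =>
    have h1 : (((σ v).getD 1 : ℤˣ) : ℤ) = 1 := by rw [h]; rfl
    rw [h1]
    refine congrArg (fun e => single e (1 : ℤ)) ?_
    funext i
    simp [Pi.single_apply, Subtype.ext_iff]
  · next a h =>
    have h1 : (σ v).getD 1 = a := by rw [h]; rfl
    rw [h1]
    have : (fun i : σ.Free => if i.1 = v then (1 : ℤ) else 0) = 0 := by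
      funext i
      refine if_neg fun hi => ?_
      have := i.2
      rw [hi, h] at this
      exact absurd this (by simp)
    rw [this]
    rfl

variable [Fintype V]

theorem specialise_single (σ : Labelling V) (e : V → ℤ) (c : ℤ) :
    specialise σ (single e c) = single (fun i => e i.1) (c * σ.sign e) := by
  have h : ∏ v, σ.value v ^ e v =
      Laurent.unitHom σ.Free (σ.sign e, Multiplicative.ofAdd fun i => e i.1) := by
    simp only [Labelling.value_eq, ← map_zpow, ← map_prod]
    congr 1
    refine Prod.ext ?_ ?_
    · simp [Prod.fst_prod, Labelling.sign]
    · rw [Prod.snd_prod]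
      apply Multiplicative.toAdd.injective
      funext i
      simp [toAdd_prod]
  rw [specialise, Laurent.eval_single, h, Laurent.coe_unitHom]
  rw [AddMonoidAlgebra.intCast_def, single_mul_single, zero_add]
  simp

/-- The exchange polynomial of a quiver at a vertex. -/
def quiverExchange [Quiver.{w} V] (j : V) : Laurent V :=
  single (fun i => (Nat.card (i ⟶ j) : ℤ)) 1 + single (fun i => (Nat.card (j ⟶ i) : ℤ)) 1

/-- Two signed monomials cancel when their exponents agree and their signs have product -1. Arrows
between j and a free vertex run in one direction only, so equal exponents there mean that there are
none; the product of the signs counts the arrows to vertices labelled -1 modulo 2. -/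
theorem isPolycule_iff [Quiver.{w} V] [∀ a b : V, Finite (a ⟶ b)]
    (no_two_cycles : ∀ a b : V, Nonempty (a ⟶ b) → IsEmpty (b ⟶ a)) {σ : Labelling V} {j : V}
    (hj : σ j = none) : IsPolycule σ j ↔ specialise σ (quiverExchange j) = 0 := by
  rw [quiverExchange, map_add, specialise_single, specialise_single, one_mul, one_mul,
    single_add_single_eq_zero_iff, ← Labelling.sign_add]
  have hs : σ.sign ((fun i => (Nat.card (i ⟶ j) : ℤ)) + fun i => (Nat.card (j ⟶ i) : ℤ)) =
      (-1) ^ ∑ v with σ v = some (-1), (Nat.card (v ⟶ j) + Nat.card (j ⟶ v)) := by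
    rw [← Labelling.sign_natCast]
    congr 1
  rw [hs, IsPolycule]
  refine ⟨fun ⟨_, h1, h2⟩ => ⟨?_, h2.neg_one_pow⟩, fun ⟨h1, h2⟩ => ⟨hj, ?_, ?_⟩⟩
  · funext i
    have h3 : IsEmpty (i.1 ⟶ j) := not_nonempty_iff.1 fun h => h1 i.1 (Or.inl h) i.2
    have h4 : IsEmpty (j ⟶ i.1) := not_nonempty_iff.1 fun h => h1 i.1 (Or.inr h) i.2
    simp
  · intro i hi hfree
    have h3 := congrFun h1 ⟨i, hfree⟩
    simp only [Nat.cast_inj] at h3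
    rcases hi with hi | hi
    · have := no_two_cycles _ _ hi
      rw [Nat.card_of_isEmpty (α := (j ⟶ i))] at h3
      exact Nat.card_pos.ne' h3
    · have := no_two_cycles _ _ hi
      rw [Nat.card_of_isEmpty (α := (i ⟶ j))] at h3
      exact Nat.card_pos.ne h3
  · rw [← Nat.not_even_iff_odd]
    intro h
    rw [h.neg_one_pow] at h2
    exact absurd h2 (by decide)

end Specialise

/-! ### The inclusion of Laurent polynomials into rational functions -/

section ToField

variable {V : Type u} [Fintype V]

theorem Laurent.toField_single (e : V → ℤ) (c : ℤ) :
    Laurent.toField V (single e c) = c * monomialAt (initialVar V) e :=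
  Laurent.evalAt_single _ _ e c

/-- A large power of the product of all variables turns a Laurent polynomial into a polynomial, and
polynomials embed in their fraction field. -/
theorem Laurent.toField_injective : Function.Injective (Laurent.toField V) := by
  classical
  rw [injective_iff_map_eq_zero]
  intro g hg
  have key : ∀ f : Laurent V, ∃ N₀ : ℕ, ∀ N : ℕ, N₀ ≤ N → ∃ p : MvPolynomial V ℤ,
      MvPolynomial.eval₂Hom (Int.castRingHom (Laurent V))
        (fun v => single (Pi.single v 1) 1) p = f * single (fun _ => (N : ℤ)) 1 := by
    intro f
    induction f using AddMonoidAlgebra.induction_linear with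
    | zero => exact ⟨0, fun N _ => ⟨0, by simp⟩⟩
    | add f g hf hg =>
      obtain ⟨N₁, h₁⟩ := hf
      obtain ⟨N₂, h₂⟩ := hg
      refine ⟨max N₁ N₂, fun N hN => ?_⟩
      obtain ⟨p, hp⟩ := h₁ N (le_trans (le_max_left _ _) hN)
      obtain ⟨q, hq⟩ := h₂ N (le_trans (le_max_right _ _) hN)
      exact ⟨p + q, by rw [map_add, hp, hq, add_mul]⟩
    | single e c =>
      refine ⟨∑ v, (e v).natAbs, fun N hN => ?_⟩
      have hle : ∀ v, 0 ≤ e v + N := fun v => by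
        have := Finset.single_le_sum (f := fun v => (e v).natAbs) (fun _ _ => Nat.zero_le _)
          (Finset.mem_univ v)
        have h : (e v).natAbs ≤ N := this.trans hN
        omega
      refine ⟨MvPolynomial.C c * ∏ v, MvPolynomial.X v ^ (e v + N).toNat, ?_⟩
      rw [map_mul, map_prod, single_mul_single, mul_one]
      simp only [map_pow, MvPolynomial.coe_eval₂Hom, MvPolynomial.eval₂_C, MvPolynomial.eval₂_X,
        single_pow, one_pow, prod_single, Finset.prod_const_one]
      rw [eq_intCast, AddMonoidAlgebra.intCast_def, single_mul_single, zero_add, mul_one]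
      congr 1
      funext i
      simp [Finset.sum_apply, Pi.single_apply, hle i]
  obtain ⟨N, hN⟩ := key g
  obtain ⟨p, hp⟩ := hN N le_rfl
  have hcomp : (Laurent.toField V).comp (MvPolynomial.eval₂Hom (Int.castRingHom (Laurent V))
      (fun v => single (Pi.single v 1) 1)) = algebraMap (MvPolynomial V ℤ) (RatFunField V) := by
    refine MvPolynomial.ringHom_ext (fun c => by simp) fun v => ?_
    rw [RingHom.comp_apply, MvPolynomial.coe_eval₂Hom, MvPolynomial.eval₂_X,
      Laurent.toField_single, monomialAt_single]
    simp [initialVar]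
  have hp0 : p = 0 := by
    refine (injective_iff_map_eq_zero _).1
      (IsFractionRing.injective (MvPolynomial V ℤ) (RatFunField V)) p ?_
    rw [← hcomp, RingHom.comp_apply, hp, map_mul, hg, zero_mul]
  rw [hp0, map_zero] at hp
  have := congrArg (· * single (-(fun _ => (N : ℤ))) 1) hp
  simpa [mul_assoc, single_mul_single, ← AddMonoidAlgebra.one_def] using this.symm

end ToField

/-! ### Seeds of a quiver as specialisations of seeds with principal coefficients -/

section Principal

variable {V : Type u}

/-- The specialisation of the coefficient variables to `1`. -/
def forgetCoefficients (V : Type u) : Laurent (V ⊕ V) →+* Laurent V :=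
  mapDomainRingHom ℤ
    ({ toFun := fun e v => e (Sum.inl v), map_zero' := rfl, map_add' := fun _ _ => rfl } :
      (V ⊕ V → ℤ) →+ (V → ℤ))

theorem forgetCoefficients_single (e : V ⊕ V → ℤ) (c : ℤ) :
    forgetCoefficients V (single e c) = single (fun v => e (Sum.inl v)) c := by
  simp [forgetCoefficients]

/-- The exchange matrix of a quiver with principal coefficients. -/
def principalMatrix (V : Type u) [DecidableEq V] [Quiver.{w} V] : V ⊕ V → V ⊕ V → ℤ
  | .inl a, .inl c => Nat.card (a ⟶ c) - Nat.card (c ⟶ a)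
  | .inr a, .inl c => if a = c then 1 else 0
  | .inl a, .inr c => if c = a then -1 else 0
  | .inr _, .inr _ => 0

theorem zpow_inExponent {W : Type u} [Fintype W] {K : Type*} [Field K] (x : W → K)
    (b : W → W → ℤ) (k : W) : monomialAt x (inExponent b k) = ∏ i, x i ^ (b i k).toNat :=
  Finset.prod_congr rfl fun _ _ => zpow_natCast _ _

/-- Removing 2-cycles amounts to taking the positive part of the signed number of arrows. -/
theorem mutateArrows_eq [DecidableEq V] {q : V → V → ℕ} {b : V ⊕ V → V ⊕ V → ℤ}
    (hb : ∀ i j, b i j = -b j i) (hq : ∀ a c, q a c = (b (.inl a) (.inl c)).toNat) (k a c : V) :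
    mutateArrows q k a c = (mutateMatrix b (.inl k) (.inl a) (.inl c)).toNat := by
  simp only [mutateArrows, mutateMatrix, Sum.inl.injEq, ← hb]
  split_ifs
  · exact hq c a
  · rw [← hq, ← hq, ← hq, ← hq]
    have h1 := hq a c
    have h2 := hq c a
    rw [hb (.inl c)] at h2
    rw [mul_comm (q k a : ℤ)]
    rw [← Nat.cast_mul, ← Nat.cast_mul]
    omega

theorem principalMatrix_skew [DecidableEq V] [Quiver.{w} V] (i j : V ⊕ V) :
    principalMatrix V i j = -principalMatrix V j i := by
  rcases i with a | a <;> rcases j with c | c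
  · simp [principalMatrix]
  · simp only [principalMatrix]; split_ifs <;> rfl
  · simp only [principalMatrix]; split_ifs <;> rfl
  · rfl

theorem toNat_principalMatrix [DecidableEq V] [Quiver.{w} V]
    (no_two_cycles : ∀ a b : V, Nonempty (a ⟶ b) → IsEmpty (b ⟶ a)) (a c : V) :
    (principalMatrix V (.inl a) (.inl c)).toNat = Nat.card (a ⟶ c) := by
  simp only [principalMatrix]
  by_cases h : Nonempty (a ⟶ c)
  · have := no_two_cycles _ _ h
    rw [Nat.card_of_isEmpty (α := (c ⟶ a))]
    simp
  · have := not_nonempty_iff.1 h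
    rw [Nat.card_of_isEmpty (α := (a ⟶ c))]
    simp

theorem forgetCoefficients_exchangePoly [DecidableEq V] [Quiver.{w} V]
    (no_two_cycles : ∀ a b : V, Nonempty (a ⟶ b) → IsEmpty (b ⟶ a)) (j : V) :
    forgetCoefficients V (exchangePoly (principalMatrix V) (.inl j)) = quiverExchange j := by
  rw [exchangePoly, map_add, forgetCoefficients_single, forgetCoefficients_single,
    quiverExchange]
  simp only [inExponent_apply, Pi.neg_apply, ← principalMatrix_skew (.inl j),
    toNat_principalMatrix no_two_cycles]

/-! ### Lifting mutation sequences to principal coefficients -/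

section Lift

/-- A seed with principal coefficients lifts a seed of a quiver. -/
structure IsLift [Fintype V] {K : Type*} [Field K] (ι : Laurent (V ⊕ V) →+* K) (b : V ⊕ V → V ⊕ V → ℤ)
    (x : V ⊕ V → K) (s : Seed V) (F : V ⊕ V → Laurent (V ⊕ V)) : Prop where
  skew : ∀ i j, b i j = -b j i
  arrows : ∀ a c, s.arrows a c = (b (.inl a) (.inl c)).toNat
  lift : ∀ i, ι (F i) = x i
  cluster : ∀ v, Laurent.toField V (forgetCoefficients V (F (.inl v))) = s.cluster v
  coefficient : ∀ v, forgetCoefficients V (F (.inr v)) = 1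
  pos : ∀ i, 0 < Laurent.eval (1 : V → ℤˣ) (forgetCoefficients V (F i))

variable [DecidableEq V] [Fintype V]

/-- The positive value at the all-ones point shows that x_k stays nonzero when the coefficients are
set to 1, so the exchange relation can be specialised and then divided by it. -/
theorem IsLift.mutate {K : Type*} [Field K] {ι : Laurent (V ⊕ V) →+* K}
    (hι : Function.Injective ι) {b : V ⊕ V → V ⊕ V → ℤ} {x : V ⊕ V → K} {s : Seed V}
    {F : V ⊕ V → Laurent (V ⊕ V)} (h : IsLift ι b x s F) (k : V) {G : Laurent (V ⊕ V)}
    (hG : ι G = mutateCluster b x (.inl k) (.inl k)) :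
    IsLift ι (mutateMatrix b (.inl k)) (mutateCluster b x (.inl k)) (s.mutate k)
      (Function.update F (.inl k) G) := by
  have hne : forgetCoefficients V (F (.inl k)) ≠ 0 := fun h0 => by
    have := h.pos (.inl k)
    rw [h0, map_zero] at this
    exact lt_irrefl _ this
  have hx : x (.inl k) ≠ 0 := by
    rw [← h.lift]
    refine (map_ne_zero_iff _ hι).2 fun h0 => hne ?_
    rw [h0, map_zero]
  -- Injectivity of `ι` brings the exchange relation back to Laurent polynomials, where setting
  -- coefficients to 1 is defined.
  have hmul : G * F (.inl k) = ∏ i, F i ^ (b i (.inl k)).toNat +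
      ∏ i, F i ^ (-b i (.inl k)).toNat := by
    apply hι
    simp only [map_mul, map_add, map_prod, map_pow, h.lift, hG]
    rw [mutateCluster, Function.update_self, div_mul_cancel₀ _ hx, exchange, zpow_inExponent,
      zpow_inExponent]
    rfl
  have hcl : Laurent.toField V (forgetCoefficients V G) = (s.mutate k).cluster k := by
    have hsk : s.cluster k ≠ 0 := by
      rw [← h.cluster]
      exact (map_ne_zero_iff _ Laurent.toField_injective).2 hne
    have h1 := congrArg (fun f => Laurent.toField V (forgetCoefficients V f)) hmul
    simp only [map_mul, map_add, map_prod, map_pow, Fintype.prod_sum_type, h.cluster,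
      h.coefficient, one_pow, Finset.prod_const_one, mul_one, ← h.arrows,
      ← h.skew (.inl k)] at h1
    change _ = Function.update s.cluster k _ k
    rw [Function.update_self, eq_div_iff hsk, h1]
  refine ⟨mutateMatrix_skew h.skew _, fun a c => mutateArrows_eq h.skew h.arrows k a c,
    fun i => ?_, fun v => ?_, fun v => ?_, fun i => ?_⟩
  · by_cases hi : i = .inl k
    · rw [hi, Function.update_self, hG]
    · rw [Function.update_of_ne hi, mutateCluster, Function.update_of_ne hi, h.lift]
  · by_cases hv : v = k
    · rw [hv, Function.update_self, hcl]
    · rw [Function.update_of_ne (by simpa using hv), h.cluster]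
      exact (Function.update_of_ne hv _ _).symm
  · rw [Function.update_of_ne (by simp), h.coefficient]
  · by_cases hi : i = .inl k
    · rw [hi, Function.update_self]
      have h1 := congrArg (fun f => Laurent.eval (1 : V → ℤˣ) (forgetCoefficients V f)) hmul
      simp only [map_mul, map_add, map_prod, map_pow] at h1
      refine pos_of_mul_pos_left (b := Laurent.eval (1 : V → ℤˣ)
        (forgetCoefficients V (F (.inl k)))) ?_ (h.pos _).le
      rw [h1]
      exact add_pos (Finset.prod_pos fun i _ => pow_pos (h.pos i) _)
        (Finset.prod_pos fun i _ => pow_pos (h.pos i) _)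
    · rw [Function.update_of_ne hi]
      exact h.pos i

/-- The hypothesis `hx` is the Laurent phenomenon with coefficients; it supplies the lift of each
new cluster variable. -/
theorem IsLift.foldl {K : Type*} [Field K] {ι : Laurent (V ⊕ V) →+* K}
    (hι : Function.Injective ι) (ks : List V) {b : V ⊕ V → V ⊕ V → ℤ} {x : V ⊕ V → K}
    {s : Seed V} {F : V ⊕ V → Laurent (V ⊕ V)} (h : IsLift ι b x s F)
    (hx : ∀ (ks : List V) v, ∃ G, ι G = iterCluster b x (ks.map Sum.inl) v) (v : V) :
    ∃ G, ι G = iterCluster b x (ks.map Sum.inl) (.inl v) ∧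
      Laurent.toField V (forgetCoefficients V G) = (ks.foldl Seed.mutate s).cluster v := by
  induction ks generalizing b x s F with
  | nil => exact ⟨F (.inl v), h.lift _, h.cluster v⟩
  | cons k ks ih =>
    obtain ⟨G, hG⟩ := hx [k] (.inl k)
    exact ih (h.mutate hι k hG) fun ks' => hx (k :: ks')

end Lift

/-- The initial cluster with principal coefficients. -/
def principalCluster (V : Type u) [DecidableEq V] : V ⊕ V → FractionRing (Laurent (V ⊕ V)) :=
  fun i => algebraMap (Laurent (V ⊕ V)) _ (single (Pi.single i 1) 1)

theorem principalCluster_ne_zero [DecidableEq V] (i : V ⊕ V) : principalCluster V i ≠ 0 := by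
  rw [principalCluster]
  refine (map_ne_zero_iff _ (IsFractionRing.injective _ _)).2 ?_
  exact single_ne_zero.2 one_ne_zero

variable [DecidableEq V] [Fintype V]

theorem evalAt_principalCluster :
    Laurent.evalAt (principalCluster V) principalCluster_ne_zero =
      algebraMap (Laurent (V ⊕ V)) (FractionRing (Laurent (V ⊕ V))) := by
  let u : Multiplicative (V ⊕ V → ℤ) →* (FractionRing (Laurent (V ⊕ V)))ˣ :=
    (Units.map (algebraMap (Laurent (V ⊕ V)) (FractionRing (Laurent (V ⊕ V))))).comp
      ((Laurent.unitHom (V ⊕ V)).comp (MonoidHom.inr _ _))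
  have hu : ∀ e, (u (Multiplicative.ofAdd e) : FractionRing (Laurent (V ⊕ V))) =
      algebraMap (Laurent (V ⊕ V)) _ (single e 1) := fun _ => rfl
  have hmon : ∀ e, monomialAt (principalCluster V) e =
      algebraMap (Laurent (V ⊕ V)) _ (single e 1) := by
    intro e
    have he : Multiplicative.ofAdd e = ∏ i, Multiplicative.ofAdd (Pi.single i (1 : ℤ)) ^ e i := by
      apply Multiplicative.toAdd.injective
      funext i
      rcases i with i | i <;> simp [toAdd_prod, Pi.single_apply]
    rw [← hu, he, map_prod, Units.coe_prod]
    refine Finset.prod_congr rfl fun i _ => ?_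
    rw [map_zpow, Units.val_zpow_eq_zpow_val, hu, principalCluster]
  refine RingHom.ext fun f => ?_
  induction f using AddMonoidAlgebra.induction_linear with
  | zero => simp
  | add f g hf hg => rw [map_add, map_add, hf, hg]
  | single e c =>
    have h1 : (single e c : Laurent (V ⊕ V)) = (c : Laurent (V ⊕ V)) * single e 1 := by
      rw [AddMonoidAlgebra.intCast_def, single_mul_single, zero_add, mul_one]; rfl
    rw [Laurent.evalAt_single, h1, map_mul, map_intCast]
    exact congrArg _ (hmon e)

variable [Quiver.{w} V]

/-- Independence is immediate from the identity block in the coefficient rows. -/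
theorem isAdmissible_principal :
    IsAdmissible (Set.range Sum.inl) (principalMatrix V) (principalCluster V) where
  skew := principalMatrix_skew
  indep := by
    intro c hc hbc
    funext i
    rcases i with v | v
    · have := hbc (.inr v)
      simpa [Fintype.sum_sum_type, principalMatrix] using this
    · exact hc _ (by simp)
  ne_zero := principalCluster_ne_zero
  injective := by
    rw [evalAt_principalCluster]
    exact IsFractionRing.injective _ _

theorem isLift_initialSeed
    (no_two_cycles : ∀ a b : V, Nonempty (a ⟶ b) → IsEmpty (b ⟶ a)) :
    IsLift (algebraMap (Laurent (V ⊕ V)) (FractionRing (Laurent (V ⊕ V)))) (principalMatrix V)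
      (principalCluster V) (initialSeed V) (fun i => single (Pi.single i 1) 1) where
  skew := principalMatrix_skew
  arrows a c := (toNat_principalMatrix no_two_cycles a c).symm
  lift _ := rfl
  cluster v := by
    have : (fun w => (Pi.single (Sum.inl v) 1 : V ⊕ V → ℤ) (Sum.inl w)) = Pi.single v 1 := by
      funext w
      simp [Pi.single_apply]
    rw [forgetCoefficients_single, this, Laurent.toField_single, monomialAt_single]
    simp [initialSeed]
  coefficient v := by
    rw [forgetCoefficients_single, AddMonoidAlgebra.one_def]
    congr 1
  pos i := by
    rw [forgetCoefficients_single, Laurent.eval_single]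
    simp

/-- Every cluster variable is a Laurent polynomial in the initial cluster, and it comes from a
Laurent polynomial with coefficients whose components of negative degree in `x_j` are divisible by
powers of the exchange polynomial at `j`. -/
theorem exists_toField_eq_of_mem_clusterVariables
    (no_two_cycles : ∀ a b : V, Nonempty (a ⟶ b) → IsEmpty (b ⟶ a)) {y : RatFunField V}
    (hy : y ∈ clusterVariables V) :
    ∃ F : Laurent (V ⊕ V), Laurent.toField V (forgetCoefficients V F) = y ∧
      ∀ (j : V) (n : ℕ), exchangePoly (principalMatrix V) (.inl j) ^ n ∣
        Laurent.component (Pi.evalAddMonoidHom (fun _ => ℤ) (Sum.inl j)) (-n) F := by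
  obtain ⟨ks, v, rfl⟩ := hy
  have hadm := isAdmissible_principal (V := V)
  have hup : ∀ (ks : List V) w,
      iterCluster (principalMatrix V) (principalCluster V) (ks.map Sum.inl) w ∈
        upperBound (Set.range Sum.inl) (principalMatrix V) (principalCluster V) :=
    fun ks w => hadm.iterCluster_mem_upperBound (by simp) w
  obtain ⟨F, hF, hFy⟩ := (isLift_initialSeed no_two_cycles).foldl
    (IsFractionRing.injective _ _) ks (fun ks w => by
      rw [← evalAt_principalCluster]
      exact (mem_laurentRing_iff _).1 (hup ks w).1) v
  refine ⟨F, hFy, fun j n => ?_⟩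
  -- The upper bound gives the second expansion, in the cluster mutated at j, from which
  -- divisibility follows.
  have h1 := (hup ks (.inl v)).2 (.inl j) ⟨j, rfl⟩
  have he := mutateCluster_eq_update (b := principalMatrix V) hadm.ne_zero (.inl j)
  have hx' := (hadm.mutate (k := .inl j) ⟨j, rfl⟩).ne_zero
  rw [he] at h1 hx'
  obtain ⟨g, hg⟩ := (mem_laurentRing_iff hx').1 h1
  refine Laurent.pow_dvd_component_of_evalAt_eq _ hadm.ne_zero hadm.injective (.inl j) _
    (component_exchangePoly_mul (hadm.diag _)) hx' (f := F) (g := g) ?_ n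
  rw [hg, evalAt_principalCluster, hF]

theorem isPolynomialIn_specialise {σ : Labelling V} {j : V} (hj : σ j = none)
    (h0 : specialise σ (forgetCoefficients V (exchangePoly (principalMatrix V) (.inl j))) = 0)
    {F : Laurent (V ⊕ V)} (hF : ∀ n : ℕ, exchangePoly (principalMatrix V) (.inl j) ^ n ∣
        Laurent.component (Pi.evalAddMonoidHom (fun _ => ℤ) (Sum.inl j)) (-n) F) :
    (specialise σ (forgetCoefficients V F)).IsPolynomialIn ⟨j, hj⟩ := by
  have hnonneg : ∀ (n : ℤ), 0 ≤ n → ∀ f : Laurent (V ⊕ V), specialise σ (forgetCoefficients V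
      (Laurent.component (Pi.evalAddMonoidHom (fun _ => ℤ) (Sum.inl j)) n f)) ∈
        Laurent.polynomialSubring (⟨j, hj⟩ : σ.Free) := by
    intro n hn f
    induction f using AddMonoidAlgebra.induction_linear with
    | zero => simp
    | add f g hf hg => simp only [map_add]; exact Subring.add_mem _ hf hg
    | single e c =>
      rw [Laurent.component_single]
      split_ifs with h
      · rw [forgetCoefficients_single, specialise_single]
        exact Laurent.isPolynomialIn_single (by rw [← h] at hn; exact hn) _
      · simp
  change specialise σ (forgetCoefficients V F) ∈
    Laurent.polynomialSubring (⟨j, hj⟩ : σ.Free)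
  rw [Laurent.eq_sum_component (Pi.evalAddMonoidHom (fun _ => ℤ) (Sum.inl j)) F, map_sum, map_sum]
  refine Subring.sum_mem _ fun n _ => ?_
  rcases le_or_gt 0 n with hn | hn
  · exact hnonneg n hn F
  · obtain ⟨m, rfl⟩ : ∃ m : ℕ, n = -(m : ℤ) := ⟨n.natAbs, by omega⟩
    obtain ⟨u, hu⟩ := hF m
    -- Negativity of the degree makes `m` positive, so the vanishing factor really occurs.
    rw [hu, map_mul, map_mul, map_pow, map_pow, h0, zero_pow (by omega), zero_mul]
    exact Subring.zero_mem _

theorem quiverExchange_mul_mem (j : V) :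
    Laurent.toField V (quiverExchange j * single (-Pi.single j 1) 1) ∈ clusterAlgebra V := by
  refine Subring.subset_closure ⟨[j], j, ?_⟩
  change _ = Function.update (initialSeed V).cluster j _ j
  rw [Function.update_self, map_mul, quiverExchange, map_add, Laurent.toField_single,
    Laurent.toField_single, Laurent.toField_single, monomialAt_neg, monomialAt_single]
  simp [initialSeed, monomialAt, div_eq_mul_inv]

/-- The test element is P_j / x_j: as there are no loops, any term of P_j surviving the
specialisation would have exponent -1 at j after the division. -/
theorem specialise_quiverExchange_eq_zero (no_loops : ∀ a : V, IsEmpty (a ⟶ a))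
    {σ : Labelling V} {j : V} (hj : σ j = none)
    (h : ∀ f ∈ specialisedClusterAlgebra σ, f.IsPolynomialIn ⟨j, hj⟩) :
    specialise σ (quiverExchange j) = 0 := by
  have h1 := h _ (Subring.mem_map.2 ⟨_, quiverExchange_mul_mem j, rfl⟩)
  have hsign : σ.sign (-Pi.single j 1) = 1 := by
    rw [Labelling.sign]
    refine Finset.prod_eq_one fun v _ => ?_
    by_cases hv : v = j
    · rw [hv, hj]; simp
    · simp [hv]
  rw [map_mul, specialise_single, hsign] at h1
  by_contra hne
  obtain ⟨e, he⟩ : ∃ e, (specialise σ (quiverExchange j)).coeff e ≠ 0 := by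
    by_contra! hall
    exact hne (by ext e; exact hall e)
  have hej : e ⟨j, hj⟩ = 0 := by
    by_contra hej
    refine he ?_
    rw [quiverExchange, map_add, specialise_single, specialise_single, coeff_add,
      Finsupp.add_apply, coeff_single, coeff_single, Finsupp.single_eq_of_ne,
      Finsupp.single_eq_of_ne, add_zero]
    all_goals
      rintro rfl
      exact hej (by simp)
  have h2 := h1 (e + fun i => (-Pi.single j 1 : V → ℤ) i.1) (by
    rw [coeff_mul_single_apply]
    simpa using he)
  simp [hej] at h2

end Principal

end ClusterAlg

end

theorem mainTheorem1 {V : Type*} [Fintype V] [DecidableEq V]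
    [Quiver V] [∀ a b : V, Finite (a ⟶ b)]
    (no_loops : ∀ a : V, IsEmpty (a ⟶ a))
    (no_two_cycles : ∀ a b : V, Nonempty (a ⟶ b) → IsEmpty (b ⟶ a))
    (σ : ClusterAlg.Labelling V) :
    ClusterAlg.clusterAlgebra V ≤ (ClusterAlg.Laurent.toField V).range ∧
    ∀ j : V, ClusterAlg.IsPolyamorous σ j ↔ ClusterAlg.IsPolycule σ j := by
  open ClusterAlg in
  refine ⟨Subring.closure_le.2 fun y hy => ?_, fun j => ⟨fun ⟨hj, h⟩ => ?_, fun h => ?_⟩⟩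
  · obtain ⟨F, hF, -⟩ := exists_toField_eq_of_mem_clusterVariables no_two_cycles hy
    exact ⟨_, hF⟩
  · exact (isPolycule_iff no_two_cycles hj).2 (specialise_quiverExchange_eq_zero no_loops hj h)
  · have hj : σ j = none := h.1
    have h0 := (isPolycule_iff no_two_cycles hj).1 h
    rw [← forgetCoefficients_exchangePoly no_two_cycles] at h0
    refine ⟨hj, fun f hf => ?_⟩
    obtain ⟨g, hg, rfl⟩ := Subring.mem_map.1 hf
    -- Polynomiality in x_j defines a subring, so it suffices to check the cluster variables;
    -- injectivity of `Laurent.toField` then identifies the two preimages.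
    have hle : clusterAlgebra V ≤ ((Laurent.polynomialSubring (⟨j, hj⟩ : σ.Free)).comap
        (specialise σ)).map (Laurent.toField V) := by
      refine Subring.closure_le.2 fun y hy => ?_
      obtain ⟨F, hF, hdvd⟩ := exists_toField_eq_of_mem_clusterVariables no_two_cycles hy
      exact ⟨_, isPolynomialIn_specialise hj h0 (hdvd j), hF⟩
    obtain ⟨g', hg', e⟩ := Subring.mem_map.1 (hle hg)
    rw [← Laurent.toField_injective e]
    exact hg'
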